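/- Fix a prime $p$. A ring $A$ is called *integral perfectoid* if it is $p$-torsion free, $p$-adically complete and separated, $A/pA\neq 0$, and there are $\varpi\in A$ and a unit $u\in A$ with $\varpi^p=pu$ such that the Frobenius endomorphism of $A/pA$ is surjective with kernel $\varpi(A/pA)$. For a ring $A$, its *tilt* is $A^\flat:=\varprojlim(A/pA\leftarrow A/pA\leftarrow\cdots)$, with the Frobenius as transition maps; it is functorial in $A$. A sequence $\{a_n\}_{n\ge 0}$ in $A$ is a *compatible system* for $a=a_0$ if $a_{n+1}^p=a_n$ for all $n$; it defines $a^\flat:=(\overline{a_0},\overline{a_1},\dots)\in A^\flat$. For a finite sequence $\mathbf y$ in a ring $A$, an $A$-algebra $T$ is a *big Cohen–Macaulay $A$-algebra with respect to $\mathbf y$* if $\mathbf y$ is a regular sequence on $T$ (in particular $\mathbf yT\ne T$). $W$ denotes the ring of $p$-typical Witt vectors and $[\,\cdot\,]$ the Teichmüller lift. Let $(R,\mathfrak m)$ be a complete Noetherian local domain of characteristic $0$ with residue field of characteristic $p$, and let $\mathbf x=(x_1,\dots,x_d)$ with $x_1=p$ and $d=\dim R$ be a system of parameters of $R$. Let $S$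 be an integral perfectoid $R$-algebra together with compatible systems $\{x_i^{1/p^n}\}_{n\ge0}$ in $S$ for (the images of) $x_1=p,x_2,\dots,x_d$, and let $\mathbf x^\flat=(p^\flat,x_2^\flat,\dots,x_d^\flat)$ be the corresponding sequence in $S^\flat$. Consider the following two categories, whose morphisms are all $S$-algebra (respectively $S^\flat$-algebra) homomorphisms: * $\mathcal C$: the $S$-algebras $T$ that are integral perfectoid rings and big Cohen–Macaulay $S$-algebras with respect to $\mathbf x$; * $\mathcal C^\flat$: the $S^\flat$-algebras $T$ that are perfect (the map $a\mapsto a^p$ is bijective on $T$), $p^\flat$-adically complete and separated, and big Cohen–Macaulay $S^\flat$-algebras with respect to $\mathbf x^\flat$. Then $T\mapsto T^\flat$, with $T^\flat$ an $S^\flat$-algebra through $S^\flat\to T^\flat$, is a functor $\mathcal C\to\mathcal C^\flat$ and an equivalence of categories. A quasi-inverse is the functor $T\mapsto W(T)/\vartheta W(T)$, where $\vartheta:=[p^\flat]-p$ (image in $W(T)$), and where $W(T)/\vartheta W(T)$ is an $S$-algebra through the isomorphism $S\cong W(S^\flat)/\vartheta W(S^\flat)$ induced by the surjective ring homomorphism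 $$W(S^\flat)\to S,\qquad (a_0,a_1,\dots)\mapsto\sum_{n\ge0}p^n\,\bigl(a_n^{1/p^n}\bigr)^\sharp,$$ with $a^\sharp:=\lim_{m\to\infty}\widetilde{a_{(m)}}^{\,p^m}$ for arbitrary lifts $\widetilde{a_{(m)}}\in S$ of the components $a_{(m)}\in S/pS$ of $a\in S^\flat$. -/

import Mathlib

open CategoryTheory

universe u v w

set_option linter.unusedSectionVars false

noncomputable section

/-- A system of parameters of a Noetherian local ring `R`: a sequence of `dim R` elements
generating an ideal primary to the maximal ideal. -/
def IsSystemOfParameters {R : Type w} [CommRing R] [IsLocalRing R] {d : ℕ} (x : Fin d → R) : Prop :=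
  ringKrullDim R = d ∧
    (Ideal.span (Set.range x)).radical = IsLocalRing.maximalIdeal R

/-- An integral perfectoid algebra: a `p`-torsion free, `p`-adically complete (and separated)
ring `A` with `A/pA ≠ 0`, in which some `ϖ` satisfies `ϖ ^ p = p * u` with `u` a unit, such that the
Frobenius of `A/pA` is surjective with kernel `ϖ(A/pA)`.
Here `ModP A p` is `A/pA`, and `A/pA ≠ 0` says that `p` is not a unit of `A`. -/
class IsIntegralPerfectoid (p : ℕ) (A : Type u) [CommRing A] : Prop where
  not_isUnit : ¬ IsUnit (p : A)
  torsion_free : ∀ a : A, (p : A) * a = 0 → a = 0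
  complete : IsAdicComplete (Ideal.span {(p : A)}) A
  frobenius_surjective : Function.Surjective fun a : ModP A p => a ^ p
  exists_ker : ∃ (ϖ : A) (u : Aˣ), ϖ ^ p = (p : A) * u ∧
    ∀ a : ModP A p, a ^ p = 0 ↔ a ∈ Ideal.span {(Ideal.Quotient.mk _ ϖ : ModP A p)}

instance (p : ℕ) (A : Type u) [CommRing A] [h : IsIntegralPerfectoid p A] :
    Fact (¬ IsUnit (p : A)) := ⟨h.not_isUnit⟩

instance (p : ℕ) (A : Type u) [CommRing A] [h : IsIntegralPerfectoid p A] :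
    IsAdicComplete (Ideal.span {(p : A)}) A := h.complete

/-- `T` is a big Cohen-Macaulay `A`-algebra with respect to the sequence `xs` in `A`:
the sequence is regular on `T`, including `T ≠ (xs)T`. -/
def IsBigCohenMacaulay {A : Type u} [CommRing A] (T : Type v) [CommRing T] [Algebra A T]
    (xs : List A) : Prop :=
  RingTheory.Sequence.IsRegular T xs

/-! ### Tilting

`PreTilt A p` is the inverse limit of `A/pA ← A/pA ← ⋯` along the Frobenius. -/

section Tilt

variable (p : ℕ) [Fact p.Prime]

/-- A homomorphism `A → B` induces `A/pA → B/pB`. -/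
def modPMap {A : Type u} {B : Type v} [CommRing A] [CommRing B] (f : A →+* B) :
    ModP A p →+* ModP B p :=
  Ideal.quotientMap (I := Ideal.span {(p : A)}) (Ideal.span {(p : B)}) f (by
    rw [Ideal.span_singleton_le_iff_mem, Ideal.mem_comap, map_natCast]
    exact Ideal.mem_span_singleton_self _)

/-- A homomorphism `A → B` induces `A^♭ → B^♭`, componentwise. -/
def tiltMap {A : Type u} {B : Type v} [CommRing A] [CommRing B]
    [Fact (¬ IsUnit (p : A))] [Fact (¬ IsUnit (p : B))] (f : A →+* B) :
    PreTilt A p →+* PreTilt B p :=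
  Perfection.map p (modPMap p f)

theorem tiltMap_id {A : Type u} [CommRing A] [Fact (¬ IsUnit (p : A))] :
    tiltMap p (RingHom.id A) = RingHom.id (PreTilt A p) := by
  refine RingHom.ext fun y => Subtype.ext (funext fun n => ?_)
  change modPMap p (RingHom.id A) (y.1 n) = y.1 n
  obtain ⟨a, ha⟩ := Ideal.Quotient.mk_surjective (y.1 n)
  rw [← ha]
  rfl

theorem tiltMap_comp {A B C : Type*} [CommRing A] [CommRing B] [CommRing C]
    [Fact (¬ IsUnit (p : A))] [Fact (¬ IsUnit (p : B))] [Fact (¬ IsUnit (p : C))]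
    (g : B →+* C) (f : A →+* B) :
    tiltMap p (g.comp f) = (tiltMap p g).comp (tiltMap p f) := by
  refine RingHom.ext fun y => Subtype.ext (funext fun n => ?_)
  change modPMap p (g.comp f) (y.1 n) = modPMap p g (modPMap p f (y.1 n))
  obtain ⟨a, ha⟩ := Ideal.Quotient.mk_surjective (y.1 n)
  rw [← ha]
  rfl

/-- The element `a^♭ = (a 0, a 1, a 2, …)` of the tilt defined by a compatible system of elements,
that is, a sequence with `a (n + 1) ^ p = a n`. -/
def flat {A : Type u} [CommRing A] (a : ℕ → A) (ha : ∀ n, a (n + 1) ^ p = a n) : PreTilt A p :=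
  ⟨fun n => Ideal.Quotient.mk _ (a n), fun n => by rw [← map_pow, ha]⟩

variable (S : Type u) [CommRing S] [IsIntegralPerfectoid p S]

/-- Integral perfectoid big Cohen-Macaulay `S`-algebras with respect to `xs`. -/
def perfectoidBCM (xs : List S) : ObjectProperty (CommAlgCat.{v} S) :=
  fun T => IsIntegralPerfectoid p T ∧ IsBigCohenMacaulay T xs

/-- `t`-adically complete perfect big Cohen-Macaulay `S^♭`-algebras with respect to `ys`. -/
def perfectBCM (t : PreTilt S p) (ys : List (PreTilt S p)) :
    ObjectProperty (CommAlgCat.{v} (PreTilt S p)) :=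
  fun T => IsAdicComplete (Ideal.span {t}) T ∧ PerfectRing T p ∧ IsBigCohenMacaulay T ys

/-- The tilt `T^♭` of an `S`-algebra `T`, as an `S^♭`-algebra through `S^♭ → T^♭`. -/
def tiltObj (T : Type v) [CommRing T] [Algebra S T] [Fact (¬ IsUnit (p : T))] :
    CommAlgCat.{v} (PreTilt S p) :=
  @CommAlgCat.of (PreTilt S p) _ (PreTilt T p) _ (tiltMap p (algebraMap S T)).toAlgebra

/-- The tilt of a homomorphism of `S`-algebras. -/
def tiltHom {T : Type v} {T' : Type v} [CommRing T] [Algebra S T] [Fact (¬ IsUnit (p : T))]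
    [CommRing T'] [Algebra S T'] [Fact (¬ IsUnit (p : T'))] (f : T →ₐ[S] T') :
    tiltObj p S T ⟶ tiltObj p S T' :=
  letI := (tiltMap p (algebraMap S T)).toAlgebra
  letI := (tiltMap p (algebraMap S T')).toAlgebra
  CommAlgCat.ofHom (X := PreTilt T p) (Y := PreTilt T' p)
    { tiltMap p f.toRingHom with
      commutes' := fun s => by
        change ((tiltMap p f.toRingHom).comp (tiltMap p (algebraMap S T))) s = _
        rw [← tiltMap_comp, AlgHom.toRingHom_eq_coe, AlgHom.comp_algebraMap]
        rfl }

/-- The functor `T ↦ T^♭`. -/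
def tiltFunctor (xs : List S) :
    (perfectoidBCM.{u, v} p S xs).FullSubcategory ⥤ CommAlgCat.{v} (PreTilt S p) where
  obj T :=
    haveI := T.property.1
    tiltObj p S T.obj
  map {T T'} f :=
    haveI := T.property.1
    haveI := T'.property.1
    tiltHom p S f.hom.hom
  map_id T := by
    have := T.property.1
    apply CommAlgCat.hom_ext
    apply AlgHom.ext
    exact fun y => RingHom.congr_fun (tiltMap_id p (A := T.obj)) y
  map_comp {T T' T''} f g := by
    have := T.property.1
    have := T'.property.1
    have := T''.property.1
    apply CommAlgCat.hom_ext
    apply AlgHom.ext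
    exact fun y => RingHom.congr_fun
      (tiltMap_comp p g.hom.hom.toRingHom f.hom.hom.toRingHom) y

end Tilt

/-! ### Untilting -/

section Untilt

variable (p : ℕ) [Fact p.Prime]

/-- The element `ϑ = [t] - p` of `W(B)`, where `[t]` is the Teichmüller lift of `t`. -/
def vartheta {B : Type v} [CommRing B] (t : B) : WittVector p B :=
  WittVector.teichmuller p t - (p : WittVector p B)

/-- The ring `W(B)/ϑW(B)`. -/
abbrev UntiltRing {B : Type v} [CommRing B] (t : B) : Type v :=
  WittVector p B ⧸ Ideal.span {vartheta p t}

theorem map_vartheta {B : Type u} {C : Type v} [CommRing B] [CommRing C] (f : B →+* C) (t : B) :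
    WittVector.map f (vartheta p t) = vartheta p (f t) := by
  rw [vartheta, vartheta, map_sub, WittVector.map_teichmuller, map_natCast]

section Kernel

variable {p} {S : Type u} [CommRing S] [IsIntegralPerfectoid p S] {π : ℕ → S}

theorem fontaineTheta_surjective_of_perfectoid :
    Function.Surjective (WittVector.fontaineTheta S p) :=
  surjective_fontaineTheta (IsIntegralPerfectoid.frobenius_surjective (p := p) (A := S))

theorem untilt_flat (a : ℕ → S) (ha : ∀ n, a (n + 1) ^ p = a n) :
    (flat p a ha).untilt = a 0 :=
  Perfection.teichmuller₀_mapMonoidHom_idealQuotientMk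
    (I := Ideal.span {(p : S)}) (x := (⟨a, ha⟩ : Perfection S p))

theorem fontaineTheta_vartheta (hπ0 : π 0 = p) (hπ : ∀ n, π (n + 1) ^ p = π n) :
    WittVector.fontaineTheta S p (vartheta p (flat p π hπ)) = 0 := by
  rw [vartheta, map_sub, WittVector.fontaineTheta_teichmuller, map_natCast, untilt_flat, hπ0,
    sub_self]

theorem pow_compatible (hπ : ∀ n, π (n + 1) ^ p = π n) (n : ℕ) : π n ^ p ^ n = π 0 := by
  induction n with
  | zero => simp
  | succ n ih => rw [pow_succ', pow_mul, hπ, ih]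

theorem mul_compatible_eq_zero (hπ0 : π 0 = p) (hπ : ∀ n, π (n + 1) ^ p = π n) (n : ℕ) {a : S}
    (h : π n * a = 0) : a = 0 := by
  apply IsIntegralPerfectoid.torsion_free (p := p)
  rw [← hπ0, ← pow_compatible hπ n]
  have h1 : 0 < p ^ n := pow_pos (Fact.out : p.Prime).pos n
  rw [← Nat.sub_add_cancel h1, pow_succ, mul_assoc, h, mul_zero]

/-- If `p ∣ a ^ p` then `p^{1/p} ∣ a`. -/
theorem compatible_one_dvd (hπ0 : π 0 = p) (hπ : ∀ n, π (n + 1) ^ p = π n) {a : S}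
    (h : (p : S) ∣ a ^ p) : π 1 ∣ a := by
  obtain ⟨ϖ, u, hu, hker⟩ := IsIntegralPerfectoid.exists_ker (p := p) (A := S)
  have key : ∀ b : S, (p : S) ∣ b ^ p → ϖ ∣ b := by
    intro b hb
    have h1 := (hker (Ideal.Quotient.mk _ b)).1 (by
      rw [← map_pow, Ideal.Quotient.eq_zero_iff_mem]
      exact Ideal.mem_span_singleton.2 hb)
    obtain ⟨c, hc⟩ := Ideal.mem_span_singleton.1 h1
    obtain ⟨c, rfl⟩ := Ideal.Quotient.mk_surjective c
    rw [← map_mul, Ideal.Quotient.mk_eq_mk_iff_sub_mem, Ideal.mem_span_singleton] at hc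
    obtain ⟨e, he⟩ := hc
    have h2 : (p : S) = ϖ ^ p * ((u⁻¹ : Sˣ) : S) := by
      rw [hu, mul_assoc, Units.mul_inv, mul_one]
    have h3 : ϖ ∣ (p : S) := by
      rw [h2]
      exact Dvd.dvd.mul_right (dvd_pow_self _ (Fact.out : p.Prime).ne_zero) _
    rw [sub_eq_iff_eq_add.1 he]
    exact dvd_add (Dvd.dvd.mul_right h3 _) (dvd_mul_right _ _)
  obtain ⟨v, hv⟩ := key (π 1) (by rw [hπ, hπ0])
  have hv1 : (u : S) * v ^ p = 1 := by
    have h4 : (p : S) * ((u : S) * v ^ p - 1) = 0 := by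
      have h5 := congrArg (· ^ p) hv
      simp only [hπ, hπ0, mul_pow, hu] at h5
      rw [mul_sub, ← mul_assoc, ← h5, mul_one, sub_self]
    exact sub_eq_zero.1 (IsIntegralPerfectoid.torsion_free (p := p) _ h4)
  have hvu : IsUnit v :=
    (isUnit_pow_iff (Fact.out : p.Prime).ne_zero).1 (IsUnit.of_mul_eq_one_right _ hv1)
  rw [hv]
  exact hvu.mul_right_dvd.2 (key a h)

theorem dvd_sub_pow {a b : S} (h : (p : S) ∣ a ^ p - b ^ p) : (p : S) ∣ (a - b) ^ p := by
  rw [← Ideal.mem_span_singleton, ← Ideal.Quotient.eq_zero_iff_mem] at h ⊢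
  rw [map_pow, map_sub, sub_pow_char (R := ModP S p) (p := p), ← map_pow, ← map_pow, ← map_sub, h]

theorem compatible_dvd_of_pow (hπ0 : π 0 = p) (hπ : ∀ n, π (n + 1) ^ p = π n) (n : ℕ) {a : S}
    (h : π n ∣ a ^ p) : π (n + 1) ∣ a := by
  obtain ⟨b, hb⟩ := h
  obtain ⟨c, hc⟩ := IsIntegralPerfectoid.frobenius_surjective (p := p) (A := S)
    (Ideal.Quotient.mk _ b)
  obtain ⟨c, rfl⟩ := Ideal.Quotient.mk_surjective c
  simp only at hc
  rw [← map_pow, Ideal.Quotient.mk_eq_mk_iff_sub_mem, Ideal.mem_span_singleton] at hc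
  have h1 : (p : S) ∣ (a - π (n + 1) * c) ^ p := by
    apply dvd_sub_pow
    rw [hb, mul_pow, hπ, ← mul_sub, ← neg_sub, mul_neg, dvd_neg]
    exact hc.mul_left _
  have h2 : π (n + 1) ∣ π 1 := by
    clear h1 hc hb c b a
    induction n with
    | zero => exact dvd_rfl
    | succ n ih =>
      refine dvd_trans ?_ ih
      rw [← hπ (n + 1)]
      exact dvd_pow_self _ (Fact.out : p.Prime).ne_zero
  have h3 := dvd_add (h2.trans (compatible_one_dvd hπ0 hπ h1)) (dvd_mul_right (π (n + 1)) c)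
  rwa [sub_add_cancel] at h3

theorem compatible_dvd (hπ0 : π 0 = p) (hπ : ∀ n, π (n + 1) ^ p = π n) (n : ℕ) {a : S}
    (h : (p : S) ∣ a ^ p ^ n) : π n ∣ a := by
  induction n generalizing a with
  | zero => simpa [hπ0] using h
  | succ n ih =>
    apply compatible_dvd_of_pow hπ0 hπ
    apply ih
    rwa [← pow_mul, ← pow_succ']

theorem pretilt_pow_eq (y : PreTilt S p) (n : ℕ) : y.1 n ^ p ^ n = y.1 0 := by
  induction n with
  | zero => simp
  | succ n ih => rw [pow_succ', pow_mul, y.2, ih]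

/-- The kernel of `S^♭ → S/pS` is generated by `p^♭`. -/
theorem flat_dvd (hπ0 : π 0 = p) (hπ : ∀ n, π (n + 1) ^ p = π n) (y : PreTilt S p)
    (hy : y.1 0 = 0) : flat p π hπ ∣ y := by
  have hex : ∀ n, ∃ b : S, (Ideal.Quotient.mk _ (π n * b) : ModP S p) = y.1 n := by
    intro n
    obtain ⟨a, ha⟩ := Ideal.Quotient.mk_surjective (y.1 n)
    have h1 : π n ∣ a := by
      apply compatible_dvd hπ0 hπ
      rw [← Ideal.mem_span_singleton, ← Ideal.Quotient.eq_zero_iff_mem, map_pow, ha,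
        pretilt_pow_eq, hy]
    obtain ⟨b, rfl⟩ := h1
    exact ⟨b, ha⟩
  choose b hb using hex
  have hp : 2 ≤ p := (Fact.out : p.Prime).two_le
  -- consecutive quotients agree after one more Frobenius
  have hz : ∀ n, (Ideal.Quotient.mk _ ((b (n + 2) ^ p) ^ p) : ModP S p)
      = Ideal.Quotient.mk _ (b (n + 1) ^ p) := by
    intro n
    have h1 : (p : S) ∣ π (n + 1) * (b (n + 2) ^ p - b (n + 1)) := by
      rw [← Ideal.mem_span_singleton, ← Ideal.Quotient.eq_zero_iff_mem, mul_sub, map_sub, hb,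
        ← hπ (n + 1), ← mul_pow, map_pow, hb, y.2, sub_self]
    obtain ⟨e, he⟩ := h1
    have hpos : 0 < p ^ (n + 1) := pow_pos (Fact.out : p.Prime).pos _
    have h2 : b (n + 2) ^ p - b (n + 1) = π (n + 1) ^ (p ^ (n + 1) - 1) * e := by
      rw [← sub_eq_zero]
      apply mul_compatible_eq_zero hπ0 hπ (n + 1)
      rw [mul_sub, he, ← mul_assoc, ← pow_succ', Nat.sub_add_cancel hpos, pow_compatible hπ, hπ0,
        sub_self]
    rw [Ideal.Quotient.mk_eq_mk_iff_sub_mem, Ideal.mem_span_singleton]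
    have h3 : (p : S) ∣ (b (n + 2) ^ p - b (n + 1)) ^ p := by
      rw [h2, mul_pow, ← pow_mul, mul_comm (_ - 1), pow_mul, hπ, ← hπ0, ← pow_compatible hπ n]
      apply Dvd.dvd.mul_right
      apply pow_dvd_pow
      have : p ^ (n + 1) = p ^ n * p := pow_succ _ _
      have h4 : 0 < p ^ n := pow_pos (Fact.out : p.Prime).pos _
      have : p ^ n * 2 ≤ p ^ n * p := Nat.mul_le_mul_left _ hp
      omega
    rw [← Ideal.mem_span_singleton, ← Ideal.Quotient.eq_zero_iff_mem] at h3 ⊢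
    rw [map_pow, map_sub, sub_pow_char (R := ModP S p) (p := p), ← map_pow, ← map_pow, ← map_sub] at h3
    exact h3
  refine ⟨⟨fun n => Ideal.Quotient.mk _ (b (n + 1) ^ p), fun n => ?_⟩, ?_⟩
  · rw [← map_pow]
    exact hz n
  · refine Subtype.ext (funext fun n => ?_)
    change y.1 n = Ideal.Quotient.mk _ (π n) * Ideal.Quotient.mk _ (b (n + 1) ^ p)
    rw [← map_mul, ← hπ n, ← mul_pow, map_pow, hb, y.2]

/-- The kernel of `θ : W(S^♭) → S` is generated by `ϑ`. -/
theorem ker_fontaineTheta_le (hπ0 : π 0 = p) (hπ : ∀ n, π (n + 1) ^ p = π n) :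
    RingHom.ker (WittVector.fontaineTheta S p) ≤ Ideal.span {vartheta p (flat p π hπ)} := by
  set q := vartheta p (flat p π hπ) with hq
  have hstep : ∀ w : RingHom.ker (WittVector.fontaineTheta S p),
      ∃ (a : WittVector p (PreTilt S p)) (w' : RingHom.ker (WittVector.fontaineTheta S p)),
        (w : WittVector p (PreTilt S p)) = q * a + p * w' := by
    rintro ⟨w, hw⟩
    have h0 : (w.coeff 0).1 0 = 0 := by
      have := WittVector.mk_fontaineTheta (R := S) (p := p) w
      rw [RingHom.mem_ker.1 hw, map_zero] at this
      exact this.symm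
    obtain ⟨z, hz⟩ := flat_dvd hπ0 hπ _ h0
    have h1 : w - WittVector.teichmuller p (flat p π hπ * z) ∈
        Ideal.span {(p : WittVector p (PreTilt S p))} := by
      rw [← WittVector.ker_constantCoeff, RingHom.mem_ker, map_sub, sub_eq_zero]
      exact hz.trans (WittVector.teichmuller_coeff_zero p _).symm
    obtain ⟨w1, hw1⟩ := Ideal.mem_span_singleton.1 h1
    have h2 : w = q * WittVector.teichmuller p z + p * (WittVector.teichmuller p z + w1) := by
      rw [sub_eq_iff_eq_add.1 hw1, map_mul, hq, vartheta]
      ring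
    refine ⟨WittVector.teichmuller p z, ⟨WittVector.teichmuller p z + w1, ?_⟩, h2⟩
    rw [RingHom.mem_ker] at hw ⊢
    apply IsIntegralPerfectoid.torsion_free (p := p)
    rw [h2, map_add, map_mul, hq, fontaineTheta_vartheta hπ0 hπ, zero_mul, zero_add, map_mul,
      map_natCast] at hw
    exact hw
  choose a w' hw' using hstep
  intro w hw
  let ws : ℕ → RingHom.ker (WittVector.fontaineTheta S p) := fun n => w'^[n] ⟨w, hw⟩
  let s : ℕ → WittVector p (PreTilt S p) := fun n =>
    ∑ i ∈ Finset.range n, (p : WittVector p (PreTilt S p)) ^ i * a (ws i)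
  have hs : ∀ n, w = q * s n + (p : WittVector p (PreTilt S p)) ^ n * ws n := by
    intro n
    induction n with
    | zero => simp [s, ws]
    | succ n ih =>
      have h1 := hw' (ws n)
      have h2 : ws (n + 1) = w' (ws n) := Function.iterate_succ_apply' _ _ _
      have h3 : s (n + 1) = s n + (p : WittVector p (PreTilt S p)) ^ n * a (ws n) :=
        Finset.sum_range_succ _ _
      rw [h2, h3, ih]
      conv_lhs => rw [h1]
      ring
  obtain ⟨L, hL⟩ := IsPrecomplete.prec
    (inferInstance : IsPrecomplete (Ideal.span {(p : WittVector p (PreTilt S p))})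
      (WittVector p (PreTilt S p))) (f := s) (by
    intro m n hmn
    rw [SModEq.sub_mem, smul_eq_mul, Ideal.mul_top, Ideal.span_singleton_pow,
      Ideal.mem_span_singleton, ← dvd_neg, neg_sub]
    have hsplit : s m + ∑ i ∈ Finset.Ico m n, (p : WittVector p (PreTilt S p)) ^ i * a (ws i) = s n :=
      Finset.sum_range_add_sum_Ico _ hmn
    rw [← hsplit, add_sub_cancel_left]
    exact Finset.dvd_sum fun i hi => Dvd.dvd.mul_right (pow_dvd_pow _ (Finset.mem_Ico.1 hi).1) _)
  rw [Ideal.mem_span_singleton]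
  refine ⟨L, ?_⟩
  rw [IsHausdorff.eq_iff_smodEq (I := Ideal.span {(p : WittVector p (PreTilt S p))})]
  intro n
  have := hL n
  rw [SModEq.sub_mem, smul_eq_mul, Ideal.mul_top, Ideal.span_singleton_pow,
    Ideal.mem_span_singleton] at this ⊢
  nth_rewrite 1 [hs n]
  rw [add_sub_right_comm, ← mul_sub]
  exact dvd_add (this.mul_left _) (dvd_mul_right _ _)

end Kernel

variable {S : Type u} [CommRing S] [IsIntegralPerfectoid p S]

/-- The structure map `S → W(B)/ϑW(B)` for an `S^♭`-algebra `B`: the map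
`S ≅ W(S^♭)/ϑW(S^♭) → W(B)/ϑW(B)`, where the isomorphism is induced by `θ : W(S^♭) → S`. -/
def untiltStr (π : ℕ → S) (hπ0 : π 0 = p) (hπ : ∀ n, π (n + 1) ^ p = π n)
    (B : Type v) [CommRing B] [Algebra (PreTilt S p) B] :
    S →+* UntiltRing p (algebraMap (PreTilt S p) B (flat p π hπ)) :=
  RingHom.liftOfSurjective (WittVector.fontaineTheta S p) fontaineTheta_surjective_of_perfectoid
    ⟨(Ideal.Quotient.mk _).comp (WittVector.map (algebraMap (PreTilt S p) B)), by
      refine (ker_fontaineTheta_le hπ0 hπ).trans ?_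
      rw [Ideal.span_singleton_le_iff_mem, RingHom.mem_ker, RingHom.comp_apply, map_vartheta,
        Ideal.Quotient.eq_zero_iff_mem]
      exact Ideal.mem_span_singleton_self _⟩

theorem untiltStr_fontaineTheta (π : ℕ → S) (hπ0 : π 0 = p) (hπ : ∀ n, π (n + 1) ^ p = π n)
    (B : Type v) [CommRing B] [Algebra (PreTilt S p) B] (w : WittVector p (PreTilt S p)) :
    untiltStr p π hπ0 hπ B (WittVector.fontaineTheta S p w) =
      Ideal.Quotient.mk _ (WittVector.map (algebraMap (PreTilt S p) B) w) :=
  RingHom.liftOfSurjective_comp_apply ..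

/-- The ring `W(B)/ϑW(B)` as an `S`-algebra. -/
def untiltObj (π : ℕ → S) (hπ0 : π 0 = p) (hπ : ∀ n, π (n + 1) ^ p = π n)
    (B : Type v) [CommRing B] [Algebra (PreTilt S p) B] : CommAlgCat.{v} S :=
  @CommAlgCat.of S _ (UntiltRing p (algebraMap (PreTilt S p) B (flat p π hπ))) _
    (untiltStr p π hπ0 hπ B).toAlgebra

/-- The homomorphism `W(B)/ϑW(B) → W(C)/ϑW(C)` induced by `W(f)`. -/
def untiltHom (π : ℕ → S) (hπ0 : π 0 = p) (hπ : ∀ n, π (n + 1) ^ p = π n)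
    {B C : Type v} [CommRing B] [Algebra (PreTilt S p) B] [CommRing C] [Algebra (PreTilt S p) C]
    (f : B →ₐ[PreTilt S p] C) : untiltObj p π hπ0 hπ B ⟶ untiltObj p π hπ0 hπ C :=
  letI := (untiltStr p π hπ0 hπ B).toAlgebra
  letI := (untiltStr p π hπ0 hπ C).toAlgebra
  CommAlgCat.ofHom (X := UntiltRing p (algebraMap (PreTilt S p) B (flat p π hπ)))
    (Y := UntiltRing p (algebraMap (PreTilt S p) C (flat p π hπ)))
    { Ideal.quotientMap
        (I := Ideal.span {vartheta p (algebraMap (PreTilt S p) B (flat p π hπ))})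
        (Ideal.span {vartheta p (algebraMap (PreTilt S p) C (flat p π hπ))})
        (WittVector.map f.toRingHom) (by
          rw [Ideal.span_singleton_le_iff_mem, Ideal.mem_comap, map_vartheta,
            AlgHom.toRingHom_eq_coe, RingHom.coe_coe, AlgHom.commutes]
          exact Ideal.mem_span_singleton_self _) with
      commutes' := fun s => by
        obtain ⟨w, rfl⟩ := fontaineTheta_surjective_of_perfectoid (p := p) s
        change Ideal.quotientMap _ _ _ (untiltStr p π hπ0 hπ B _) = untiltStr p π hπ0 hπ C _
        rw [untiltStr_fontaineTheta, untiltStr_fontaineTheta, Ideal.quotientMap_mk]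
        congr 1
        ext n
        simp [WittVector.map_coeff] }

theorem compatible_zero_eq {R : Type w} [CommRing R] [Algebra R S] {x : R} (hx : x = p) {π : ℕ → S}
    (hπ : π 0 = algebraMap R S x) : π 0 = p := by
  rw [hπ, hx, map_natCast]

/-- The functor `B ↦ W(B)/ϑW(B)`, where `ϑ = [p^♭] - p` and `p^♭` is the element of `S^♭` defined
by the compatible system `π` of `p`-power roots of `p`. -/
def untiltFunctor (π : ℕ → S) (hπ0 : π 0 = p) (hπ : ∀ n, π (n + 1) ^ p = π n) :
    CommAlgCat.{v} (PreTilt S p) ⥤ CommAlgCat.{v} S where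
  obj B := untiltObj p π hπ0 hπ B
  map f := untiltHom p π hπ0 hπ f.hom
  map_id B := by
    apply CommAlgCat.hom_ext
    apply AlgHom.ext
    intro y
    obtain ⟨w, rfl⟩ := Ideal.Quotient.mk_surjective y
    refine congrArg (Ideal.Quotient.mk _) (?_ : WittVector.map _ w = w)
    ext n
    rw [WittVector.map_coeff]
    rfl
  map_comp {B C D} f g := by
    apply CommAlgCat.hom_ext
    apply AlgHom.ext
    intro y
    obtain ⟨w, rfl⟩ := Ideal.Quotient.mk_surjective y
    refine congrArg (Ideal.Quotient.mk _)
      (?_ : WittVector.map _ w = WittVector.map g.hom.toRingHom (WittVector.map f.hom.toRingHom w))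
    ext n
    rw [WittVector.map_coeff, WittVector.map_coeff, WittVector.map_coeff]
    rfl

end Untilt

end

/-! Everything rests on the comparison `T/pT ≅ T^♭/p^♭T^♭` and its counterpart `W(B)/(p, ϑ) ≅ B/tB`,
where `t` is the image of `p^♭` in `B`.

Unit: for `T` perfectoid, `θ : W(T^♭) → T` is surjective with kernel `ϑW(T^♭)`
(`ker_fontaineTheta_le`, itself a consequence of `flat_dvd`), so `W(T^♭)/ϑ ≅ T`. The map `θ` is
natural in `T` (`fontaineTheta_map_tiltMap`), which makes the isomorphism both `S`-linear and
natural.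

Untilting: let `B` be perfect of characteristic `p` with `t` a nonzerodivisor. Since `ϑ ≡ t` modulo
`p`, both `p, ϑ` and `ϑ, p` behave as regular sequences in `W(B)`. Hence `W(B)/ϑ` is `p`-torsion
free and `p`-adically complete (`natCast_pow_dvd_of_dvd_vartheta_mul`). Its reduction modulo `p` is
`B/tB`, whose Frobenius is surjective with kernel generated by `t^{1/p}`.

Counit: as `B` is perfect, `B → B/tB ≅ W(B)/(p, ϑ)` lifts uniquely to `B → (W(B)/ϑ)^♭`. Component
`n` of the lift has kernel `t^{p^n}B`, so the lift is bijective exactly because `B` is `t`-adically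
complete and separated.

Cohen–Macaulayness: the first terms `p` and `p^♭` are nonzerodivisors on the two sides, the
quotients by them agree, and `x_i`, `x_i^♭` act equally on that quotient, so regularity passes
across in both directions (`isRegular_cons_of_quotient`). -/

noncomputable section

/-! ### Adic completeness for principal ideals, and transfer of regular sequences -/

section Prelim

open scoped Pointwise in
theorem mem_span_singleton_pow_smul_top_iff {A M : Type*} [CommRing A] [CommRing M] [Algebra A M]
    {t : A} {n : ℕ} {x : M} :
    x ∈ (Ideal.span {t} ^ n • ⊤ : Submodule A M) ↔ algebraMap A M t ^ n ∣ x := by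
  rw [Ideal.span_singleton_pow, Submodule.ideal_span_singleton_smul,
    Submodule.mem_smul_pointwise_iff_exists, ← map_pow]
  constructor
  · rintro ⟨b, -, rfl⟩
    exact ⟨b, Algebra.smul_def _ _⟩
  · rintro ⟨b, rfl⟩
    exact ⟨b, trivial, Algebra.smul_def _ _⟩

/-- Only successive differences need checking, by telescoping. Divisibility takes place in `M`, so
the base ring of the ideal becomes irrelevant. -/
theorem isAdicComplete_span_singleton_iff {A M : Type*} [CommRing A] [CommRing M] [Algebra A M]
    {t : A} : IsAdicComplete (Ideal.span {t}) M ↔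
      (∀ x : M, (∀ n, algebraMap A M t ^ n ∣ x) → x = 0) ∧
      ∀ f : ℕ → M, (∀ n, algebraMap A M t ^ n ∣ f (n + 1) - f n) →
        ∃ L, ∀ n, algebraMap A M t ^ n ∣ L - f n := by
  have key : ∀ (n : ℕ) (x y : M),
      x ≡ y [SMOD (Ideal.span {t} ^ n • ⊤ : Submodule A M)] ↔ algebraMap A M t ^ n ∣ x - y := by
    intro n x y
    rw [SModEq.sub_mem, mem_span_singleton_pow_smul_top_iff]
  constructor
  · intro h
    refine ⟨fun x hx => h.haus' x fun n => (key n x 0).2 (by simpa using hx n), fun f hf => ?_⟩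
    obtain ⟨L, hL⟩ := h.prec' f (by
      intro m n hmn
      rw [key]
      induction n, hmn using Nat.le_induction with
      | base => simp
      | succ n hmn ih =>
        have h2 := dvd_sub ih ((pow_dvd_pow (algebraMap A M t) hmn).trans (hf n))
        convert h2 using 1
        ring)
    refine ⟨L, fun n => ?_⟩
    rw [← neg_sub, dvd_neg]
    exact (key n _ _).1 (hL n)
  · rintro ⟨h1, h2⟩
    refine { haus' := fun x hx => h1 x fun n => ?_, prec' := fun f hf => ?_ }
    · simpa using (key n x 0).1 (hx n)
    · obtain ⟨L, hL⟩ := h2 f (fun n => by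
        rw [← neg_sub, dvd_neg]
        exact (key n _ _).1 (hf n.le_succ))
      refine ⟨L, fun n => (key n _ _).2 ?_⟩
      rw [← neg_sub, dvd_neg]
      exact hL n

theorem isAdicComplete_span_singleton_self_iff {M : Type*} [CommRing M] {t : M} :
    IsAdicComplete (Ideal.span {t}) M ↔ (∀ x : M, (∀ n, t ^ n ∣ x) → x = 0) ∧
      ∀ f : ℕ → M, (∀ n, t ^ n ∣ f (n + 1) - f n) → ∃ L, ∀ n, t ^ n ∣ L - f n := by
  rw [isAdicComplete_span_singleton_iff, Algebra.algebraMap_self]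
  rfl

theorem isAdicComplete_span_singleton_algebraMap_iff {A M : Type*} [CommRing A] [CommRing M]
    [Algebra A M] {t : A} : IsAdicComplete (Ideal.span {algebraMap A M t}) M ↔
      IsAdicComplete (Ideal.span {t}) M := by
  rw [isAdicComplete_span_singleton_self_iff, isAdicComplete_span_singleton_iff]

-- The isomorphism is only additive, with scalars recorded through `φ`, so that quotients of
-- algebras over different base rings can be compared.
open scoped Pointwise in
theorem exists_quotSMulTop_addEquiv {A M Q : Type*} [CommRing A] [CommRing M] [CommRing Q]
    [Algebra A M] (φ : M →+* Q)
    (hφ : Function.Surjective φ) {a : A} (hφk : ∀ m, φ m = 0 ↔ algebraMap A M a ∣ m) :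
    ∃ e : QuotSMulTop a M ≃+ Q, ∀ (x : A) (m : QuotSMulTop a M),
      e (x • m) = φ (algebraMap A M x) * e m := by
  let : Module A Q := Module.compHom Q (φ.comp (algebraMap A M))
  let l : M →ₗ[A] Q :=
    { φ with
      map_smul' := fun x m => by
        change φ (x • m) = φ (algebraMap A M x) * φ m
        rw [Algebra.smul_def, map_mul] }
  have hl : (a • ⊤ : Submodule A M) = LinearMap.ker l := by
    ext m
    rw [LinearMap.mem_ker, Submodule.mem_smul_pointwise_iff_exists]
    refine Iff.trans ?_ (hφk m).symm
    constructor
    · rintro ⟨b, -, rfl⟩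
      exact ⟨b, Algebra.smul_def _ _⟩
    · rintro ⟨b, rfl⟩
      exact ⟨b, trivial, Algebra.smul_def _ _⟩
  let e : QuotSMulTop a M ≃ₗ[A] Q :=
    (Submodule.quotEquivOfEq _ _ hl).trans (l.quotKerEquivOfSurjective hφ)
  exact ⟨e.toAddEquiv, fun x m => e.map_smul x m⟩

/-- Regularity of a sequence depends only on the regularity of its first element and on the
quotient by that element, with the action of the remaining elements on it. -/
theorem isRegular_cons_of_quotient {A C M N Q : Type*} [CommRing A] [CommRing C] [CommRing M]
    [CommRing N] [CommRing Q] [Algebra A M] [Algebra C N] (φ : M →+* Q) (ψ : N →+* Q)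
    (hφ : Function.Surjective φ) (hψ : Function.Surjective ψ) {a : A} {c : C}
    (hφk : ∀ m, φ m = 0 ↔ algebraMap A M a ∣ m) (hψk : ∀ m, ψ m = 0 ↔ algebraMap C N c ∣ m)
    {as : List A} {cs : List C}
    (h : List.Forall₂ (fun x y => φ (algebraMap A M x) = ψ (algebraMap C N y)) as cs)
    (hreg : RingTheory.Sequence.IsRegular M (a :: as))
    (hc : ∀ y, algebraMap C N c * y = 0 → y = 0) :
    RingTheory.Sequence.IsRegular N (c :: cs) := by
  obtain ⟨e, he⟩ := exists_quotSMulTop_addEquiv φ hφ hφk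
  obtain ⟨e', he'⟩ := exists_quotSMulTop_addEquiv ψ hψ hψk
  rw [RingTheory.Sequence.isRegular_cons_iff] at hreg ⊢
  refine ⟨?_, ?_⟩
  · rw [isSMulRegular_iff_right_eq_zero_of_smul]
    intro y hy
    exact hc y (by rwa [← Algebra.smul_def])
  · refine (AddEquiv.isRegular_congr (e := e.trans e'.symm) ?_).1 hreg.2
    refine h.imp fun x y hxy m => ?_
    apply e'.injective
    simp only [AddEquiv.trans_apply, AddEquiv.apply_symm_apply, he, he', hxy]

theorem eq_zero_of_isRegular_cons {A M : Type*} [CommRing A] [CommRing M] [Algebra A M] {a : A}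
    {as : List A} (h : RingTheory.Sequence.IsRegular M (a :: as)) {m : M}
    (hm : algebraMap A M a * m = 0) : m = 0 := by
  rw [RingTheory.Sequence.isRegular_cons_iff, isSMulRegular_iff_right_eq_zero_of_smul] at h
  exact h.1 m (by rwa [Algebra.smul_def])

theorem not_isUnit_of_isRegular_cons {A M : Type*} [CommRing A] [CommRing M] [Algebra A M] {a : A}
    {as : List A} (h : RingTheory.Sequence.IsRegular M (a :: as)) :
    ¬ IsUnit (algebraMap A M a) := by
  intro hu
  rw [RingTheory.Sequence.isRegular_cons_iff] at h
  have := h.2.nontrivial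
  obtain ⟨e, -⟩ := exists_quotSMulTop_addEquiv (Ideal.Quotient.mk (Ideal.span {algebraMap A M a}))
    Ideal.Quotient.mk_surjective (a := a) (fun m => by
      rw [Ideal.Quotient.eq_zero_iff_mem, Ideal.mem_span_singleton])
  have := e.symm.toEquiv.nontrivial
  exact Ideal.Quotient.nontrivial_iff.1 this (Ideal.span_singleton_eq_top.2 hu)

end Prelim

/-! ### The tilt of a perfectoid algebra: completeness and regularity -/

section TiltLemmas

variable {p : ℕ} [Fact p.Prime] {T : Type u} [CommRing T] [IsIntegralPerfectoid p T] {π : ℕ → T}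

theorem PreTilt.coeff_surjective_of_perfectoid (n : ℕ) :
    Function.Surjective (PreTilt.coeff (O := T) (p := p) n) :=
  Perfection.coeff_surjective IsIntegralPerfectoid.frobenius_surjective n

theorem flat_dvd_iff (hπ0 : π 0 = p) (hπ : ∀ n, π (n + 1) ^ p = π n) (y : PreTilt T p) :
    flat p π hπ ∣ y ↔ PreTilt.coeff 0 y = 0 := by
  refine ⟨?_, flat_dvd hπ0 hπ y⟩
  rintro ⟨z, rfl⟩
  rw [map_mul]
  have : PreTilt.coeff 0 (flat p π hπ) = 0 := by
    change Ideal.Quotient.mk _ (π 0) = 0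
    rw [Ideal.Quotient.eq_zero_iff_mem, hπ0]
    exact Ideal.mem_span_singleton_self _
  rw [this, zero_mul]

/-- Extracting `p^n`-th roots in the perfect ring `T^♭` moves coefficient `n` to coefficient `0` and
reduces to `flat_dvd_iff`. It follows that the `p^♭`-adic topology is the inverse limit topology. -/
theorem flat_pow_dvd_iff (hπ0 : π 0 = p) (hπ : ∀ n, π (n + 1) ^ p = π n) (n : ℕ)
    (y : PreTilt T p) : flat p π hπ ^ p ^ n ∣ y ↔ PreTilt.coeff n y = 0 := by
  have hcoeff : PreTilt.coeff 0 (((frobeniusEquiv (PreTilt T p) p).symm)^[n] y)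
      = PreTilt.coeff n y := by
    rw [PreTilt.coeff_iterate_frobeniusEquiv_symm, zero_add]
  rw [← hcoeff, ← flat_dvd_iff hπ0 hπ]
  nth_rewrite 1 [← iterate_frobeniusEquiv_symm_pow_p_pow (PreTilt T p) p y n]
  constructor
  · rintro ⟨z, hz⟩
    refine ⟨((frobeniusEquiv (PreTilt T p) p).symm)^[n] z, ?_⟩
    apply (iterateFrobeniusEquiv (PreTilt T p) p n).injective
    rw [iterateFrobeniusEquiv_def, hz, iterateFrobeniusEquiv_def, mul_pow,
      iterate_frobeniusEquiv_symm_pow_p_pow]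
  · exact fun h => pow_dvd_pow_of_dvd h _

theorem isAdicComplete_flat (hπ0 : π 0 = p) (hπ : ∀ n, π (n + 1) ^ p = π n) :
    IsAdicComplete (Ideal.span {flat p π hπ}) (PreTilt T p) := by
  have hp1 : 1 < p := (Fact.out : p.Prime).one_lt
  rw [isAdicComplete_span_singleton_self_iff]
  constructor
  · intro x hx
    refine Perfection.ext fun n => ?_
    exact (flat_pow_dvd_iff hπ0 hπ n x).1 (hx _)
  · intro f hf
    have hf' : ∀ m n, m ≤ n → flat p π hπ ^ m ∣ f n - f m := by
      intro m n hmn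
      induction n, hmn using Nat.le_induction with
      | base => simp
      | succ n hmn ih =>
        rw [← sub_add_sub_cancel _ (f n)]
        exact dvd_add ((pow_dvd_pow _ hmn).trans (hf n)) ih
    -- Coefficient `n` only depends on the class modulo the `p^n`-th power of `p^♭`, so it can be
    -- read off from `f (p ^ n)`.
    let L : PreTilt T p := ⟨fun n => PreTilt.coeff n (f (p ^ n)), fun n => by
      have h1 := (flat_pow_dvd_iff hπ0 hπ n _).1
        (hf' (p ^ n) (p ^ (n + 1)) (Nat.pow_le_pow_right hp1.le n.le_succ))
      rw [map_sub, sub_eq_zero] at h1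
      exact (PreTilt.coeff_pow_p _ _).trans h1⟩
    have hL : ∀ n, flat p π hπ ^ p ^ n ∣ L - f (p ^ n) := by
      intro n
      rw [flat_pow_dvd_iff hπ0 hπ, map_sub, sub_eq_zero]
      rfl
    refine ⟨L, fun n => ?_⟩
    have hn : n ≤ p ^ n := (Nat.lt_pow_self hp1).le
    rw [← sub_add_sub_cancel _ (f (p ^ n))]
    exact dvd_add ((pow_dvd_pow _ hn).trans (hL n)) (hf' _ _ hn)

theorem eq_zero_of_flat_mul_eq_zero (hπ0 : π 0 = p) (hπ : ∀ n, π (n + 1) ^ p = π n)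
    {y : PreTilt T p} (hy : flat p π hπ * y = 0) : y = 0 := by
  refine Perfection.ext fun n => ?_
  change PreTilt.coeff n y = 0
  obtain ⟨b, hb⟩ := Ideal.Quotient.mk_surjective (PreTilt.coeff (n + 1) y)
  have h1 : (p : T) ∣ π (n + 1) * b := by
    rw [← Ideal.mem_span_singleton, ← Ideal.Quotient.eq_zero_iff_mem, map_mul, hb]
    exact congrArg (PreTilt.coeff (n + 1)) hy
  obtain ⟨e, he⟩ := h1
  have hpos : 0 < p ^ (n + 1) := pow_pos (Fact.out : p.Prime).pos _
  -- Cancelling `p^{1/p^{n+1}}` leaves `b` divisible by `p^{1 - 1/p^{n+1}}`. This does not kill `b`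
  -- modulo `p`, but `b ^ p`, which represents coefficient `n`, is divisible by `p` because `p -
  -- 1/p^n ≥ 1`.
  have h2 : b = π (n + 1) ^ (p ^ (n + 1) - 1) * e := by
    rw [← sub_eq_zero]
    apply mul_compatible_eq_zero hπ0 hπ (n + 1)
    rw [mul_sub, he, ← mul_assoc, ← pow_succ', Nat.sub_add_cancel hpos, pow_compatible hπ, hπ0,
      sub_self]
  have h3 : (p : T) ∣ b ^ p := by
    rw [h2, mul_pow, ← pow_mul, mul_comm (_ - 1), pow_mul, hπ, ← hπ0, ← pow_compatible hπ n]
    apply Dvd.dvd.mul_right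
    apply pow_dvd_pow
    have : p ^ (n + 1) = p ^ n * p := pow_succ _ _
    have h4 : 0 < p ^ n := pow_pos (Fact.out : p.Prime).pos _
    have : p ^ n * 2 ≤ p ^ n * p := Nat.mul_le_mul_left _ (Fact.out : p.Prime).two_le
    omega
  rw [← PreTilt.coeff_pow_p, ← hb]
  refine (map_pow (Ideal.Quotient.mk _) b p).symm.trans ?_
  rw [Ideal.Quotient.eq_zero_iff_mem]
  exact Ideal.mem_span_singleton.2 h3

theorem tiltMap_flat {A : Type u} {B : Type v} [CommRing A] [CommRing B]
    [Fact (¬ IsUnit (p : A))] [Fact (¬ IsUnit (p : B))] (f : A →+* B) (a : ℕ → A)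
    (ha : ∀ n, a (n + 1) ^ p = a n) :
    tiltMap p f (flat p a ha) = flat p (fun n => f (a n)) (fun n => by rw [← map_pow, ha]) :=
  rfl

theorem isAdicComplete_and_isBigCohenMacaulay_preTilt {S : Type u} [CommRing S]
    [IsIntegralPerfectoid p S] {n : ℕ} (x : Fin (n + 1) → S) (hx0 : x 0 = p)
    (r : Fin (n + 1) → ℕ → S) (hr0 : ∀ i, r i 0 = x i) (hr : ∀ i k, r i (k + 1) ^ p = r i k)
    (T : Type v) [CommRing T] [Algebra S T] [IsIntegralPerfectoid p T]
    (hT : IsBigCohenMacaulay T (List.ofFn x)) [Algebra (PreTilt S p) (PreTilt T p)]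
    (halg : algebraMap (PreTilt S p) (PreTilt T p) = tiltMap p (algebraMap S T)) :
    IsAdicComplete (Ideal.span {flat p (r 0) (hr 0)}) (PreTilt T p) ∧
      IsBigCohenMacaulay (PreTilt T p) (List.ofFn fun i => flat p (r i) (hr i)) := by
  have hπ0 : algebraMap S T (r 0 0) = p := by rw [hr0, hx0, map_natCast]
  have hπ : ∀ n, algebraMap S T (r 0 (n + 1)) ^ p = algebraMap S T (r 0 n) := fun n => by
    rw [← map_pow, hr]
  have hflat : algebraMap (PreTilt S p) (PreTilt T p) (flat p (r 0) (hr 0)) =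
    flat p (fun n => algebraMap S T (r 0 n)) hπ := by rw [halg, tiltMap_flat]
  refine ⟨?_, ?_⟩
  · rw [← isAdicComplete_span_singleton_algebraMap_iff, hflat]
    exact isAdicComplete_flat hπ0 hπ
  · rw [IsBigCohenMacaulay, List.ofFn_succ] at hT ⊢
    refine isRegular_cons_of_quotient (Ideal.Quotient.mk (Ideal.span {(p : T)}))
      (PreTilt.coeff 0) Ideal.Quotient.mk_surjective
      (PreTilt.coeff_surjective_of_perfectoid 0) ?_ ?_ ?_ hT ?_
    · intro m
      rw [Ideal.Quotient.eq_zero_iff_mem, Ideal.mem_span_singleton, hx0, map_natCast]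
    · intro m
      rw [hflat, flat_dvd_iff hπ0 hπ]
    · rw [List.forall₂_iff_get]
      refine ⟨by simp, fun i h1 h2 => ?_⟩
      simp only [List.get_ofFn, halg, tiltMap_flat]
      simp only [← hr0]
      rfl
    · intro y hy
      rw [hflat] at hy
      exact eq_zero_of_flat_mul_eq_zero hπ0 hπ hy

theorem tiltObj_mem_perfectBCM {S : Type u} [CommRing S] [IsIntegralPerfectoid p S]
    {n : ℕ} (x : Fin (n + 1) → S) (hx0 : x 0 = p) (r : Fin (n + 1) → ℕ → S)
    (hr0 : ∀ i, r i 0 = x i) (hr : ∀ i k, r i (k + 1) ^ p = r i k)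
    (T : Type v) [CommRing T] [Algebra S T] [IsIntegralPerfectoid p T]
    (hT : IsBigCohenMacaulay T (List.ofFn x)) :
    perfectBCM.{u, v} p S (flat p (r 0) (hr 0)) (List.ofFn fun i => flat p (r i) (hr i))
      (tiltObj p S T) := by
  let : Algebra (PreTilt S p) (PreTilt T p) := (tiltMap p (algebraMap S T)).toAlgebra
  obtain ⟨h1, h2⟩ := isAdicComplete_and_isBigCohenMacaulay_preTilt x hx0 r hr0 hr T hT rfl
  exact ⟨h1, (inferInstance : PerfectRing (PreTilt T p) p), h2⟩

end TiltLemmas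

/-! ### The ring `W(B)/ϑW(B)` is integral perfectoid -/

section UntiltLemmas

variable {p : ℕ} [Fact p.Prime] {B : Type v} [CommRing B] [CharP B p] [PerfectRing B p] {t : B}

theorem WittVector.natCast_dvd_iff_coeff_zero (w : WittVector p B) :
    (p : WittVector p B) ∣ w ↔ w.coeff 0 = 0 := by
  rw [← Ideal.mem_span_singleton, WittVector.mem_span_p_iff_coeff_zero_eq_zero]

theorem WittVector.eq_zero_of_natCast_pow_mul_eq_zero (n : ℕ) {w : WittVector p B}
    (h : (p : WittVector p B) ^ n * w = 0) : w = 0 := by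
  induction n with
  | zero => simpa using h
  | succ n ih =>
    apply ih
    apply WittVector.eq_zero_of_p_mul_eq_zero
    rw [← h]
    ring

theorem WittVector.exists_eq_teichmuller_add (w : WittVector p B) :
    ∃ w', w = WittVector.teichmuller p (w.coeff 0) + p * w' := by
  obtain ⟨w', h⟩ := (WittVector.natCast_dvd_iff_coeff_zero
    (w - WittVector.teichmuller p (w.coeff 0))).2 (by
      refine (map_sub (WittVector.constantCoeff (p := p)) _ _).trans ?_
      rw [sub_eq_zero]
      exact (WittVector.teichmuller_coeff_zero p _).symm)
  exact ⟨w', by rw [← h]; ring⟩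

theorem constantCoeff_vartheta (t : B) :
    WittVector.constantCoeff (vartheta p t) = t := by
  rw [vartheta, map_sub, map_natCast, CharP.cast_eq_zero, sub_zero]
  exact WittVector.teichmuller_coeff_zero p t

/-- Modulo `p`, the element `ϑ` becomes the nonzerodivisor `t` of `B = W(B)/p`. Since `p` is a
nonzerodivisor on `W(B)`, induction shows that `ϑ` remains one modulo every `p ^ n`. -/
theorem natCast_pow_dvd_of_dvd_vartheta_mul (ht : ∀ y, t * y = 0 → y = 0) (n : ℕ)
    {b : WittVector p B} (h : (p : WittVector p B) ^ n ∣ vartheta p t * b) :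
    (p : WittVector p B) ^ n ∣ b := by
  induction n generalizing b with
  | zero => simp
  | succ n ih =>
    have h1 : (p : WittVector p B) ∣ b := by
      rw [WittVector.natCast_dvd_iff_coeff_zero]
      apply ht
      have h2 := (WittVector.natCast_dvd_iff_coeff_zero _).1
        ((dvd_pow_self _ n.succ_ne_zero).trans h)
      change WittVector.constantCoeff (vartheta p t * b) = 0 at h2
      rwa [map_mul, constantCoeff_vartheta] at h2
    obtain ⟨b, rfl⟩ := h1
    obtain ⟨c, hc⟩ := h
    rw [pow_succ']
    refine mul_dvd_mul_left _ (ih ⟨c, ?_⟩)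
    rw [← sub_eq_zero]
    apply WittVector.eq_zero_of_natCast_pow_mul_eq_zero 1
    rw [pow_one, mul_sub, ← mul_assoc (p : WittVector p B) (_ ^ n), ← pow_succ', ← hc]
    ring

variable (p t) in
/-- The reduction `W(B)/ϑW(B) → B/tB`, whose kernel is generated by `p`. -/
def untiltResidue : UntiltRing p t →+* B ⧸ Ideal.span {t} :=
  Ideal.Quotient.lift _ ((Ideal.Quotient.mk _).comp WittVector.constantCoeff) (by
    intro a ha
    obtain ⟨b, rfl⟩ := Ideal.mem_span_singleton.1 ha
    rw [RingHom.comp_apply, map_mul, constantCoeff_vartheta, Ideal.Quotient.eq_zero_iff_mem]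
    exact Ideal.mem_span_singleton.2 (dvd_mul_right _ _))

theorem untiltResidue_mk (w : WittVector p B) :
    untiltResidue p t (Ideal.Quotient.mk _ w) = Ideal.Quotient.mk _ (w.coeff 0) :=
  rfl

theorem untiltResidue_mk_teichmuller (c : B) :
    untiltResidue p t (Ideal.Quotient.mk _ (WittVector.teichmuller p c)) =
      Ideal.Quotient.mk _ c := by
  rw [untiltResidue_mk, WittVector.teichmuller_coeff_zero]

theorem untiltResidue_surjective : Function.Surjective (untiltResidue p t) := by
  intro c
  obtain ⟨c, rfl⟩ := Ideal.Quotient.mk_surjective c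
  exact ⟨_, untiltResidue_mk_teichmuller c⟩

theorem mk_teichmuller_eq_natCast :
    (Ideal.Quotient.mk _ (WittVector.teichmuller p t) : UntiltRing p t) = p := by
  rw [← map_natCast (Ideal.Quotient.mk (Ideal.span {vartheta p t})),
    Ideal.Quotient.mk_eq_mk_iff_sub_mem]
  exact Ideal.mem_span_singleton_self _

/-- In the quotient by `ϑ`, `[t]` becomes `p`; a Witt vector with constant coefficient `t * z` is
`[t][z] + p * w'`, hence a multiple of `p` there. -/
theorem untiltResidue_eq_zero_iff (u : UntiltRing p t) :
    untiltResidue p t u = 0 ↔ (p : UntiltRing p t) ∣ u := by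
  constructor
  · obtain ⟨w, rfl⟩ := Ideal.Quotient.mk_surjective u
    rw [untiltResidue_mk, Ideal.Quotient.eq_zero_iff_mem, Ideal.mem_span_singleton]
    rintro ⟨z, hz⟩
    obtain ⟨w', hw'⟩ := WittVector.exists_eq_teichmuller_add w
    rw [hw', hz, map_add, map_mul, map_mul, map_mul, map_natCast, mk_teichmuller_eq_natCast]
    exact dvd_add (dvd_mul_right _ _) (dvd_mul_right _ _)
  · rintro ⟨z, rfl⟩
    rw [map_mul, ← mk_teichmuller_eq_natCast, untiltResidue_mk_teichmuller,
      Ideal.Quotient.eq_zero_iff_mem.2 (Ideal.mem_span_singleton_self _), zero_mul]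

theorem UntiltRing.eq_zero_of_natCast_mul_eq_zero (ht : ∀ y, t * y = 0 → y = 0)
    (a : UntiltRing p t) (h : (p : UntiltRing p t) * a = 0) : a = 0 := by
  obtain ⟨w, rfl⟩ := Ideal.Quotient.mk_surjective a
  rw [← map_natCast (Ideal.Quotient.mk (Ideal.span {vartheta p t})), ← map_mul,
    Ideal.Quotient.eq_zero_iff_mem, Ideal.mem_span_singleton] at h
  obtain ⟨b, hb⟩ := h
  obtain ⟨c, rfl⟩ : (p : WittVector p B) ∣ b := by
    simpa using natCast_pow_dvd_of_dvd_vartheta_mul ht 1 (b := b) (by simp [← hb])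
  rw [Ideal.Quotient.eq_zero_iff_mem, Ideal.mem_span_singleton]
  refine ⟨c, ?_⟩
  rw [← sub_eq_zero]
  apply WittVector.eq_zero_of_natCast_pow_mul_eq_zero 1
  rw [pow_one, mul_sub, hb]
  ring

theorem UntiltRing.isAdicComplete (ht : ∀ y, t * y = 0 → y = 0) :
    IsAdicComplete (Ideal.span {(p : UntiltRing p t)}) (UntiltRing p t) := by
  obtain ⟨hW1, hW2⟩ := isAdicComplete_span_singleton_self_iff.1
    (WittVector.isAdicCompleteIdealSpanP (p := p) (k := B))
  rw [isAdicComplete_span_singleton_self_iff]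
  constructor
  · intro x hx
    obtain ⟨w, rfl⟩ := Ideal.Quotient.mk_surjective x
    have h : ∀ n, ∃ a b, w = p ^ n * a + vartheta p t * b := by
      intro n
      obtain ⟨a, ha⟩ := hx n
      obtain ⟨a, rfl⟩ := Ideal.Quotient.mk_surjective a
      rw [← map_natCast (Ideal.Quotient.mk (Ideal.span {vartheta p t})), ← map_pow, ← map_mul,
        Ideal.Quotient.mk_eq_mk_iff_sub_mem, Ideal.mem_span_singleton] at ha
      obtain ⟨b, hb⟩ := ha
      exact ⟨a, b, by rw [← hb]; ring⟩
    choose a b hab using h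
    -- This shows that `ϑW(B)` is `p`-adically closed: `ϑ * (b (n + 1) - b n)` is divisible by `p ^
    -- n`, hence so is the difference itself, and the cofactors `b n` converge.
    obtain ⟨L, hL⟩ := hW2 b (fun n => by
      apply natCast_pow_dvd_of_dvd_vartheta_mul ht
      refine ⟨a n - p * a (n + 1), ?_⟩
      linear_combination hab n - hab (n + 1))
    rw [Ideal.Quotient.eq_zero_iff_mem, Ideal.mem_span_singleton]
    refine ⟨L, ?_⟩
    rw [← sub_eq_zero]
    apply hW1
    intro n
    obtain ⟨e, he⟩ := hL n
    refine ⟨a n - vartheta p t * e, ?_⟩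
    linear_combination hab n - vartheta p t * he
  · intro f hf
    choose d hd using hf
    obtain ⟨g0, hg0⟩ := Ideal.Quotient.mk_surjective (f 0)
    have hd' : ∀ n, ∃ e : WittVector p B, Ideal.Quotient.mk _ e = d n :=
      fun n => Ideal.Quotient.mk_surjective _
    choose e he using hd'
    -- Lifting the differences rather than the terms makes the lifted sequence Cauchy in `W(B)`.
    let g : ℕ → WittVector p B := fun n => g0 + ∑ i ∈ Finset.range n, p ^ i * e i
    have hgs : ∀ n, g (n + 1) - g n = p ^ n * e n := by
      intro n
      simp only [g, Finset.sum_range_succ]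
      ring
    have hg : ∀ n, Ideal.Quotient.mk _ (g n) = f n := by
      intro n
      induction n with
      | zero => simpa [g] using hg0
      | succ n ih =>
        rw [sub_eq_iff_eq_add.1 (hgs n), map_add, ih, map_mul, map_pow, map_natCast, he, ← hd]
        ring
    obtain ⟨L, hL⟩ := hW2 g (fun n => ⟨_, hgs n⟩)
    refine ⟨Ideal.Quotient.mk _ L, fun n => ?_⟩
    obtain ⟨c, hc⟩ := hL n
    exact ⟨Ideal.Quotient.mk _ c, by rw [← hg, ← map_sub, hc, map_mul, map_pow, map_natCast]⟩

theorem UntiltRing.isIntegralPerfectoid (ht : ∀ y, t * y = 0 → y = 0) (htu : ¬ IsUnit t) :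
    IsIntegralPerfectoid p (UntiltRing p t) where
  not_isUnit h := by
    have h1 := h.map (untiltResidue p t)
    rw [(untiltResidue_eq_zero_iff _).2 dvd_rfl, isUnit_zero_iff, eq_comm,
      ← map_one (Ideal.Quotient.mk _), Ideal.Quotient.eq_zero_iff_mem,
      Ideal.mem_span_singleton] at h1
    exact htu (isUnit_of_dvd_one h1)
  torsion_free := UntiltRing.eq_zero_of_natCast_mul_eq_zero ht
  complete := UntiltRing.isAdicComplete ht
  frobenius_surjective a := by
    obtain ⟨u, rfl⟩ := Ideal.Quotient.mk_surjective a
    obtain ⟨c, hc⟩ := Ideal.Quotient.mk_surjective (untiltResidue p t u)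
    refine ⟨Ideal.Quotient.mk _ (Ideal.Quotient.mk _
      (WittVector.teichmuller p ((frobeniusEquiv B p).symm c))), ?_⟩
    simp only
    rw [← map_pow, ← map_pow, ← map_pow, frobeniusEquiv_symm_pow_p,
      Ideal.Quotient.mk_eq_mk_iff_sub_mem, Ideal.mem_span_singleton, ← untiltResidue_eq_zero_iff,
      map_sub, untiltResidue_mk_teichmuller, hc, sub_self]
  exists_ker := by
    -- The choice `ϖ = [t^{1/p}]` gives `ϖ ^ p = [t] = p`, so the unit is `1`. In `B/tB`, if `c ^ p
    -- = t * e` then `c = t^{1/p} * e^{1/p}`.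
    have hϖ : (Ideal.Quotient.mk _ (WittVector.teichmuller p ((frobeniusEquiv B p).symm t)) :
        UntiltRing p t) ^ p = p := by
      rw [← map_pow, ← map_pow, frobeniusEquiv_symm_pow_p, mk_teichmuller_eq_natCast]
    refine ⟨Ideal.Quotient.mk _ (WittVector.teichmuller p ((frobeniusEquiv B p).symm t)), 1,
      by rw [hϖ, Units.val_one, mul_one], fun a => ?_⟩
    rw [Ideal.mem_span_singleton]
    constructor
    · intro ha
      obtain ⟨u, rfl⟩ := Ideal.Quotient.mk_surjective a
      obtain ⟨c, hc⟩ := Ideal.Quotient.mk_surjective (untiltResidue p t u)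
      rw [← map_pow, Ideal.Quotient.eq_zero_iff_mem, Ideal.mem_span_singleton,
        ← untiltResidue_eq_zero_iff, map_pow, ← hc, ← map_pow, Ideal.Quotient.eq_zero_iff_mem,
        Ideal.mem_span_singleton] at ha
      obtain ⟨e, he⟩ := ha
      have hce : c = (frobeniusEquiv B p).symm t * (frobeniusEquiv B p).symm e := by
        rw [← map_mul, ← he, frobeniusEquiv_symm_pow]
      refine ⟨Ideal.Quotient.mk _ (Ideal.Quotient.mk _
        (WittVector.teichmuller p ((frobeniusEquiv B p).symm e))), ?_⟩
      rw [← map_mul, ← map_mul, ← map_mul, ← hce,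
        Ideal.Quotient.mk_eq_mk_iff_sub_mem, Ideal.mem_span_singleton, ← untiltResidue_eq_zero_iff,
        map_sub, untiltResidue_mk_teichmuller, hc, sub_self]
    · rintro ⟨b, rfl⟩
      rw [mul_pow, ← map_pow, hϖ,
        Ideal.Quotient.eq_zero_iff_mem.2 (Ideal.mem_span_singleton_self _), zero_mul]

end UntiltLemmas

/-! ### The untilt as a big Cohen–Macaulay `S`-algebra -/

section UntiltObj

variable {p : ℕ} [Fact p.Prime] {S : Type u} [CommRing S] [IsIntegralPerfectoid p S]

theorem charP_of_preTilt_algebra (B : Type v) [CommRing B] [Nontrivial B]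
    [Algebra (PreTilt S p) B] : CharP B p := by
  refine (CharP.charP_iff_prime_eq_zero (Fact.out : p.Prime)).2 ?_
  rw [← map_natCast (algebraMap (PreTilt S p) B), CharP.cast_eq_zero, map_zero]

/-- Here `a 0 = θ([a^♭])`. Thus `x_i` acts on `W(B)/ϑ` as `[x_i^♭]`, whose residue in `B/tB` is that
of `x_i^♭`. -/
theorem untiltStr_apply_zero (π : ℕ → S) (hπ0 : π 0 = p) (hπ : ∀ n, π (n + 1) ^ p = π n)
    (B : Type v) [CommRing B] [Algebra (PreTilt S p) B] (a : ℕ → S)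
    (ha : ∀ n, a (n + 1) ^ p = a n) :
    untiltStr p π hπ0 hπ B (a 0) =
      Ideal.Quotient.mk _
        (WittVector.teichmuller p (algebraMap (PreTilt S p) B (flat p a ha))) := by
  rw [← untilt_flat a ha, ← WittVector.fontaineTheta_teichmuller, untiltStr_fontaineTheta,
    WittVector.map_teichmuller]

theorem isBigCohenMacaulay_untiltRing {n : ℕ} (x : Fin (n + 1) → S) (r : Fin (n + 1) → ℕ → S)
    (hr0 : ∀ i, r i 0 = x i) (hπ0 : r 0 0 = p) (hr : ∀ i k, r i (k + 1) ^ p = r i k)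
    (B : Type v) [CommRing B] [Algebra (PreTilt S p) B] [CharP B p] [PerfectRing B p]
    (hB : IsBigCohenMacaulay B (List.ofFn fun i => flat p (r i) (hr i)))
    [Algebra S (UntiltRing p (algebraMap (PreTilt S p) B (flat p (r 0) (hr 0))))]
    (halg : algebraMap S (UntiltRing p (algebraMap (PreTilt S p) B (flat p (r 0) (hr 0)))) =
      untiltStr p (r 0) hπ0 (hr 0) B) :
    IsBigCohenMacaulay (UntiltRing p (algebraMap (PreTilt S p) B (flat p (r 0) (hr 0))))
      (List.ofFn x) := by
  rw [IsBigCohenMacaulay, List.ofFn_succ] at hB ⊢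
  have hp : algebraMap S (UntiltRing p (algebraMap (PreTilt S p) B (flat p (r 0) (hr 0)))) (x 0) =
      p := by rw [← hr0, hπ0, map_natCast]
  refine isRegular_cons_of_quotient (Ideal.Quotient.mk _) (untiltResidue p _)
    Ideal.Quotient.mk_surjective untiltResidue_surjective ?_ ?_ ?_ hB ?_
  · intro m
    rw [Ideal.Quotient.eq_zero_iff_mem, Ideal.mem_span_singleton]
  · intro m
    rw [untiltResidue_eq_zero_iff, hp]
  · rw [List.forall₂_iff_get]
    refine ⟨by simp, fun i h1 h2 => ?_⟩
    simp only [List.get_ofFn, halg, ← hr0]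
    rw [untiltStr_apply_zero _ _ _ _ _ (hr _), untiltResidue_mk_teichmuller]
    rfl
  · rw [hp]
    exact UntiltRing.eq_zero_of_natCast_mul_eq_zero fun y hy => eq_zero_of_isRegular_cons hB hy

theorem untiltObj_mem_perfectoidBCM {n : ℕ} (x : Fin (n + 1) → S) (r : Fin (n + 1) → ℕ → S)
    (hr0 : ∀ i, r i 0 = x i) (hπ0 : r 0 0 = p) (hr : ∀ i k, r i (k + 1) ^ p = r i k)
    (B : Type v) [CommRing B] [Algebra (PreTilt S p) B] [PerfectRing B p]
    (hB : IsBigCohenMacaulay B (List.ofFn fun i => flat p (r i) (hr i))) :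
    perfectoidBCM.{u, v} p S (List.ofFn x) (untiltObj p (r 0) hπ0 (hr 0) B) := by
  have := RingTheory.Sequence.IsRegular.nontrivial hB
  have := charP_of_preTilt_algebra (p := p) (S := S) B
  let : Algebra S (UntiltRing p (algebraMap (PreTilt S p) B (flat p (r 0) (hr 0)))) :=
    (untiltStr p (r 0) hπ0 (hr 0) B).toAlgebra
  have h1 := isBigCohenMacaulay_untiltRing x r hr0 hπ0 hr B hB rfl
  rw [IsBigCohenMacaulay, List.ofFn_succ] at hB
  have h2 : IsIntegralPerfectoid p (UntiltRing p
      (algebraMap (PreTilt S p) B (flat p (r 0) (hr 0)))) :=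
    UntiltRing.isIntegralPerfectoid (fun y hy => eq_zero_of_isRegular_cons hB hy)
      (not_isUnit_of_isRegular_cons hB)
  exact ⟨h2, h1⟩

end UntiltObj

/-! ### Naturality of `θ` -/

section Naturality

variable {p : ℕ} [Fact p.Prime]

/-- Iterating `w = [w_0] + p * w'` makes the two maps agree modulo every `p ^ n`, and the target is
`p`-adically separated. -/
theorem WittVector.ringHom_ext_of_teichmuller {B : Type u} {T : Type v} [CommRing B] [CommRing T]
    [CharP B p] [PerfectRing B p] [IsAdicComplete (Ideal.span {(p : T)}) T]
    {φ ψ : WittVector p B →+* T}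
    (h : ∀ b, φ (WittVector.teichmuller p b) = ψ (WittVector.teichmuller p b)) : φ = ψ := by
  ext w
  rw [← sub_eq_zero]
  apply (isAdicComplete_span_singleton_self_iff.1 ‹IsAdicComplete (Ideal.span {(p : T)}) T›).1
  intro n
  induction n generalizing w with
  | zero => simp
  | succ n ih =>
    obtain ⟨w', hw'⟩ := WittVector.exists_eq_teichmuller_add w
    rw [hw', map_add, map_add, h, add_sub_add_left_eq_sub, map_mul, map_mul, map_natCast,
      map_natCast, ← mul_sub, pow_succ']
    exact mul_dvd_mul_left _ (ih w')

variable {S : Type u} {T : Type v} [CommRing S] [CommRing T]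
  [Fact (¬ IsUnit (p : S))] [Fact (¬ IsUnit (p : T))]
  [IsAdicComplete (Ideal.span {(p : S)}) S] [IsAdicComplete (Ideal.span {(p : T)}) T]

/-- The compatible system consists of the elements `(y^{1/p^n})^♯`. Identities about `♯` can thus be
checked on actual `p`-power roots. -/
theorem PreTilt.exists_eq_flat (y : PreTilt S p) :
    ∃ (a : ℕ → S) (ha : ∀ n, a (n + 1) ^ p = a n), y = flat p a ha := by
  refine ⟨fun n => PreTilt.untilt (((frobeniusEquiv (PreTilt S p) p).symm)^[n] y), fun n => ?_, ?_⟩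
  · rw [← map_pow, Function.iterate_succ_apply', frobeniusEquiv_symm_pow_p]
  · refine Perfection.ext fun n => ?_
    change PreTilt.coeff n y = Ideal.Quotient.mk _ (PreTilt.untilt _)
    rw [PreTilt.mk_untilt_eq_coeff_zero, PreTilt.coeff_iterate_frobeniusEquiv_symm, zero_add]

theorem untilt_flat_of_isAdicComplete (a : ℕ → S) (ha : ∀ n, a (n + 1) ^ p = a n) :
    (flat p a ha).untilt = a 0 :=
  Perfection.teichmuller₀_mapMonoidHom_idealQuotientMk
    (I := Ideal.span {(p : S)}) (x := (⟨a, ha⟩ : Perfection S p))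

theorem untilt_tiltMap (f : S →+* T) (y : PreTilt S p) :
    (tiltMap p f y).untilt = f y.untilt := by
  obtain ⟨a, ha, rfl⟩ := PreTilt.exists_eq_flat y
  rw [tiltMap_flat, untilt_flat_of_isAdicComplete, untilt_flat_of_isAdicComplete]

theorem fontaineTheta_map_tiltMap (f : S →+* T) (w : WittVector p (PreTilt S p)) :
    WittVector.fontaineTheta T p (WittVector.map (tiltMap p f) w) =
      f (WittVector.fontaineTheta S p w) := by
  have : (WittVector.fontaineTheta T p).comp (WittVector.map (tiltMap p f)) =
      f.comp (WittVector.fontaineTheta S p) := by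
    apply WittVector.ringHom_ext_of_teichmuller
    intro b
    simp only [RingHom.comp_apply, WittVector.map_teichmuller, WittVector.fontaineTheta_teichmuller,
      untilt_tiltMap]
  exact RingHom.congr_fun this w

end Naturality

/-! ### The isomorphism `W(T^♭)/ϑW(T^♭) ≅ T` -/

section Unit

variable {p : ℕ} [Fact p.Prime] {S : Type u} [CommRing S] [IsIntegralPerfectoid p S]
  {π : ℕ → S} (hπ0 : π 0 = p) (hπ : ∀ n, π (n + 1) ^ p = π n)
  (T : Type v) [CommRing T] [Algebra S T] [IsIntegralPerfectoid p T]
  [Algebra (PreTilt S p) (PreTilt T p)]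
  (halg : algebraMap (PreTilt S p) (PreTilt T p) = tiltMap p (algebraMap S T))

include hπ0 halg in
theorem ker_fontaineTheta_eq_span : RingHom.ker (WittVector.fontaineTheta T p) =
    Ideal.span {vartheta p (algebraMap (PreTilt S p) (PreTilt T p) (flat p π hπ))} := by
  have h0 : algebraMap S T (π 0) = p := by rw [hπ0, map_natCast]
  have h1 : ∀ n, algebraMap S T (π (n + 1)) ^ p = algebraMap S T (π n) := fun n => by
    rw [← map_pow, hπ]
  rw [halg, tiltMap_flat]
  refine le_antisymm (ker_fontaineTheta_le (π := fun n => algebraMap S T (π n)) h0 h1) ?_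
  rw [Ideal.span_singleton_le_iff_mem, RingHom.mem_ker]
  exact fontaineTheta_vartheta (π := fun n => algebraMap S T (π n)) h0 h1

/-- The isomorphism `W(T^♭)/ϑW(T^♭) ≅ T` induced by `θ`. -/
def untiltPreTiltEquiv :
    UntiltRing p (algebraMap (PreTilt S p) (PreTilt T p) (flat p π hπ)) ≃+* T :=
  (Ideal.quotEquivOfEq (ker_fontaineTheta_eq_span hπ0 hπ T halg).symm).trans
    (RingHom.quotientKerEquivOfSurjective
      (fontaineTheta_surjective_of_perfectoid (p := p) (S := T)))

theorem untiltPreTiltEquiv_mk (w : WittVector p (PreTilt T p)) :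
    untiltPreTiltEquiv hπ0 hπ T halg (Ideal.Quotient.mk _ w) = WittVector.fontaineTheta T p w :=
  rfl

theorem untiltPreTiltEquiv_untiltStr (s : S) :
    untiltPreTiltEquiv hπ0 hπ T halg (untiltStr p π hπ0 hπ (PreTilt T p) s) =
      algebraMap S T s := by
  obtain ⟨w, rfl⟩ := fontaineTheta_surjective_of_perfectoid (p := p) s
  rw [untiltStr_fontaineTheta, untiltPreTiltEquiv_mk, halg, fontaineTheta_map_tiltMap]

end Unit

/-! ### The isomorphism `B ≅ (W(B)/ϑW(B))^♭` -/

section Counit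

variable {p : ℕ} [Fact p.Prime] {B : Type v} [CommRing B] [CharP B p] [PerfectRing B p] (t : B)

variable (p) in
/-- The isomorphism of `W(B)/(p, ϑ)` and `B/tB`. -/
def modPUntiltEquiv : ModP (UntiltRing p t) p ≃+* B ⧸ Ideal.span {t} :=
  (Ideal.quotEquivOfEq (by
    ext u
    rw [RingHom.mem_ker, untiltResidue_eq_zero_iff, Ideal.mem_span_singleton])).trans
    (RingHom.quotientKerEquivOfSurjective (untiltResidue_surjective (p := p) (t := t)))

theorem modPUntiltEquiv_mk (u : UntiltRing p t) :
    modPUntiltEquiv p t (Ideal.Quotient.mk _ u) = untiltResidue p t u :=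
  rfl

variable (p) in
/-- The reduction `B → B/tB ≅ W(B)/(p, ϑ)`. -/
def toModPUntilt : B →+* ModP (UntiltRing p t) p :=
  (modPUntiltEquiv p t).symm.toRingHom.comp (Ideal.Quotient.mk (Ideal.span {t}))

theorem toModPUntilt_apply (b : B) : toModPUntilt p t b =
    Ideal.Quotient.mk _ (Ideal.Quotient.mk _ (WittVector.teichmuller p b)) := by
  apply (modPUntiltEquiv p t).injective
  rw [modPUntiltEquiv_mk, untiltResidue_mk_teichmuller]
  exact (modPUntiltEquiv p t).apply_symm_apply _

theorem toModPUntilt_surjective : Function.Surjective (toModPUntilt p t) :=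
  (modPUntiltEquiv p t).symm.surjective.comp Ideal.Quotient.mk_surjective

theorem toModPUntilt_eq_zero_iff (b : B) : toModPUntilt p t b = 0 ↔ t ∣ b := by
  rw [← Ideal.mem_span_singleton, ← Ideal.Quotient.eq_zero_iff_mem]
  exact (modPUntiltEquiv p t).symm.map_eq_zero_iff

theorem dvd_iterate_frobeniusEquiv_symm_iff (n : ℕ) (b : B) :
    t ∣ ((frobeniusEquiv B p).symm)^[n] b ↔ t ^ p ^ n ∣ b := by
  nth_rewrite 2 [← iterate_frobeniusEquiv_symm_pow_p_pow B p b n]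
  constructor
  · exact fun h => pow_dvd_pow_of_dvd h _
  · rintro ⟨z, hz⟩
    refine ⟨((frobeniusEquiv B p).symm)^[n] z, ?_⟩
    apply (iterateFrobeniusEquiv B p n).injective
    rw [iterateFrobeniusEquiv_def, hz, iterateFrobeniusEquiv_def, mul_pow,
      iterate_frobeniusEquiv_symm_pow_p_pow]

variable [Fact (¬ IsUnit (p : UntiltRing p t))]

variable (p) in
/-- The homomorphism `B → (W(B)/ϑW(B))^♭`. -/
def toPreTiltUntilt : B →+* PreTilt (UntiltRing p t) p :=
  Perfection.lift p B (ModP (UntiltRing p t) p) (toModPUntilt p t)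

theorem coeff_toPreTiltUntilt (n : ℕ) (b : B) : PreTilt.coeff n (toPreTiltUntilt p t b) =
    toModPUntilt p t (((frobeniusEquiv B p).symm)^[n] b) :=
  rfl

/-- The kernel lies in the intersection of the ideals `t ^ p ^ n B`, which is zero by separatedness.
-/
theorem toPreTiltUntilt_injective (ht : IsAdicComplete (Ideal.span {t}) B) :
    Function.Injective (toPreTiltUntilt p t) := by
  rw [injective_iff_map_eq_zero]
  intro b hb
  apply (isAdicComplete_span_singleton_self_iff.1 ht).1
  intro n
  have h := coeff_toPreTiltUntilt t n b
  rw [hb, map_zero, eq_comm, toModPUntilt_eq_zero_iff, dvd_iterate_frobeniusEquiv_symm_iff] at h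
  exact (pow_dvd_pow _ (Nat.lt_pow_self (Fact.out : p.Prime).one_lt).le).trans h

theorem toPreTiltUntilt_surjective (ht : IsAdicComplete (Ideal.span {t}) B) :
    Function.Surjective (toPreTiltUntilt p t) := by
  intro y
  choose c hc using fun n => toModPUntilt_surjective (p := p) t (PreTilt.coeff n y)
  -- Since `c (n + 1) ^ p ≡ c n` modulo `t`, taking `p ^ n`-th powers in characteristic `p` gives a
  -- congruence modulo `t ^ p ^ n`. The preimage is the limit of `c n ^ p ^ n`.
  have h1 : ∀ n, t ^ p ^ n ∣ c (n + 1) ^ p ^ (n + 1) - c n ^ p ^ n := by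
    intro n
    rw [pow_succ', pow_mul, ← sub_pow_expChar_pow]
    apply pow_dvd_pow_of_dvd
    rw [← toModPUntilt_eq_zero_iff (p := p), map_sub, map_pow, hc, hc, PreTilt.coeff_pow_p,
      sub_self]
  have h2 : ∀ m n, m ≤ n → t ^ p ^ m ∣ c n ^ p ^ n - c m ^ p ^ m := by
    intro m n hmn
    induction n, hmn using Nat.le_induction with
    | base => simp
    | succ n hmn ih =>
      rw [← sub_add_sub_cancel _ (c n ^ p ^ n)]
      exact dvd_add ((pow_dvd_pow _ (Nat.pow_le_pow_right (Fact.out : p.Prime).pos hmn)).trans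
        (h1 n)) ih
  have hlt : ∀ n, n ≤ p ^ n := fun n => (Nat.lt_pow_self (Fact.out : p.Prime).one_lt).le
  obtain ⟨L, hL⟩ := (isAdicComplete_span_singleton_self_iff.1 ht).2 (fun n => c n ^ p ^ n)
    (fun n => (pow_dvd_pow _ (hlt n)).trans (h1 n))
  refine ⟨L, Perfection.ext fun n => ?_⟩
  change PreTilt.coeff n (toPreTiltUntilt p t L) = PreTilt.coeff n y
  rw [coeff_toPreTiltUntilt, ← hc, ← sub_eq_zero, ← map_sub, toModPUntilt_eq_zero_iff]
  have h3 : c n = ((frobeniusEquiv B p).symm)^[n] (c n ^ p ^ n) := by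
    apply (iterateFrobeniusEquiv B p n).injective
    rw [iterateFrobeniusEquiv_def, iterateFrobeniusEquiv_def, iterate_frobeniusEquiv_symm_pow_p_pow]
  -- Convergence at index `n` only yields divisibility by `t ^ n`; passing through index `p ^ n`
  -- yields the required `t ^ p ^ n`.
  rw [h3, ← iterate_map_sub, dvd_iterate_frobeniusEquiv_symm_iff,
    ← sub_add_sub_cancel _ (c (p ^ n) ^ p ^ (p ^ n))]
  exact dvd_add (hL (p ^ n)) (h2 n (p ^ n) (hlt n))

/-- The isomorphism `B ≅ (W(B)/ϑW(B))^♭` for a perfect `t`-adically complete ring `B`. -/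
def preTiltUntiltEquiv (ht : IsAdicComplete (Ideal.span {t}) B) :
    B ≃+* PreTilt (UntiltRing p t) p :=
  RingEquiv.ofBijective (toPreTiltUntilt p t)
    ⟨toPreTiltUntilt_injective t ht, toPreTiltUntilt_surjective t ht⟩

/-- A homomorphism from a perfect ring to a perfection is determined by its coefficient `0`, where
both sides reduce to `[g b]`. -/
theorem toPreTiltUntilt_naturality {C : Type v} [CommRing C] [CharP C p] [PerfectRing C p] (t' : C)
    [Fact (¬ IsUnit (p : UntiltRing p t'))] (g : B →+* C)
    (G : UntiltRing p t →+* UntiltRing p t')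
    (hG : ∀ w, G (Ideal.Quotient.mk _ w) = Ideal.Quotient.mk _ (WittVector.map g w)) (b : B) :
    toPreTiltUntilt p t' (g b) = tiltMap p G (toPreTiltUntilt p t b) := by
  have : (toPreTiltUntilt p t').comp g = (tiltMap p G).comp (toPreTiltUntilt p t) := by
    refine Perfection.hom_ext p fun b => ?_
    change PreTilt.coeff 0 (toPreTiltUntilt p t' (g b)) =
      modPMap p G (PreTilt.coeff 0 (toPreTiltUntilt p t b))
    rw [coeff_toPreTiltUntilt, coeff_toPreTiltUntilt, Function.iterate_zero, id,
      Function.iterate_zero, id, toModPUntilt_apply, toModPUntilt_apply]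
    change _ = Ideal.Quotient.mk _ (G _)
    rw [hG, WittVector.map_teichmuller]
  exact RingHom.congr_fun this b

theorem toPreTiltUntilt_algebraMap {S : Type u} [CommRing S] [IsIntegralPerfectoid p S]
    {π : ℕ → S} (hπ0 : π 0 = p) (hπ : ∀ n, π (n + 1) ^ p = π n) [Algebra (PreTilt S p) B]
    [Fact (¬ IsUnit (p : UntiltRing p (algebraMap (PreTilt S p) B (flat p π hπ))))]
    (s : PreTilt S p) :
    toPreTiltUntilt p (algebraMap (PreTilt S p) B (flat p π hπ)) (algebraMap (PreTilt S p) B s) =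
      tiltMap p (untiltStr p π hπ0 hπ B) s := by
  have : (toPreTiltUntilt p (algebraMap (PreTilt S p) B (flat p π hπ))).comp
      (algebraMap (PreTilt S p) B) = tiltMap p (untiltStr p π hπ0 hπ B) := by
    refine Perfection.hom_ext p fun s => ?_
    change PreTilt.coeff 0 (toPreTiltUntilt p _ (algebraMap (PreTilt S p) B s)) =
      modPMap p (untiltStr p π hπ0 hπ B) (PreTilt.coeff 0 s)
    rw [coeff_toPreTiltUntilt, Function.iterate_zero, id, toModPUntilt_apply,
      ← PreTilt.mk_untilt_eq_coeff_zero]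
    change _ = Ideal.Quotient.mk _ (untiltStr p π hπ0 hπ B _)
    rw [← WittVector.fontaineTheta_teichmuller, untiltStr_fontaineTheta, WittVector.map_teichmuller]
  exact RingHom.congr_fun this s

end Counit

/-! ### The isomorphisms in the categories of algebras, and their naturality -/

section Isos

variable {p : ℕ} [Fact p.Prime] {S : Type u} [CommRing S] [IsIntegralPerfectoid p S]
  {π : ℕ → S} (hπ0 : π 0 = p) (hπ : ∀ n, π (n + 1) ^ p = π n)

/-- The isomorphism `W(T^♭)/ϑW(T^♭) ≅ T` as an isomorphism of `S`-algebras. -/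
def untiltPreTiltAlgEquiv (T : Type v) [CommRing T] [Algebra S T] [IsIntegralPerfectoid p T]
    [Algebra (PreTilt S p) (PreTilt T p)]
    (halg : algebraMap (PreTilt S p) (PreTilt T p) = tiltMap p (algebraMap S T))
    [Algebra S (UntiltRing p (algebraMap (PreTilt S p) (PreTilt T p) (flat p π hπ)))]
    (halg' : algebraMap S (UntiltRing p (algebraMap (PreTilt S p) (PreTilt T p) (flat p π hπ))) =
      untiltStr p π hπ0 hπ (PreTilt T p)) :
    UntiltRing p (algebraMap (PreTilt S p) (PreTilt T p) (flat p π hπ)) ≃ₐ[S] T :=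
  { untiltPreTiltEquiv hπ0 hπ T halg with
    commutes' := fun s => by
      rw [halg']
      exact untiltPreTiltEquiv_untiltStr hπ0 hπ T halg s }

/-- The isomorphism of `S`-algebras `W(T^♭)/ϑW(T^♭) ≅ T`. -/
def untiltTiltIso (T : Type v) [CommRing T] [Algebra S T] [IsIntegralPerfectoid p T] :
    untiltObj p π hπ0 hπ (tiltObj p S T) ≅ CommAlgCat.of S T :=
  letI := (tiltMap p (algebraMap S T)).toAlgebra
  CommAlgCat.isoMk (@untiltPreTiltAlgEquiv p _ S _ _ π hπ0 hπ T _ _ _ _ rfl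
    (untiltStr p π hπ0 hπ (PreTilt T p)).toAlgebra rfl)

theorem untiltTiltIso_naturality {T T' : Type v} [CommRing T] [Algebra S T]
    [IsIntegralPerfectoid p T] [CommRing T'] [Algebra S T'] [IsIntegralPerfectoid p T']
    (f : T →ₐ[S] T') :
    CommAlgCat.ofHom f ≫ (untiltTiltIso hπ0 hπ T').inv =
      (untiltTiltIso hπ0 hπ T).inv ≫ untiltHom p π hπ0 hπ (tiltHom p S f).hom := by
  rw [Iso.comp_inv_eq, Category.assoc, Iso.eq_inv_comp, eq_comm]
  apply CommAlgCat.hom_ext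
  apply AlgHom.ext
  intro y
  obtain ⟨w, rfl⟩ := Ideal.Quotient.mk_surjective y
  exact fontaineTheta_map_tiltMap (p := p) f.toRingHom w

/-- The isomorphism of `S^♭`-algebras `(W(B)/ϑW(B))^♭ ≅ B`. -/
def tiltUntiltIso (B : Type v) [CommRing B] [Algebra (PreTilt S p) B] [CharP B p] [PerfectRing B p]
    (hB : IsAdicComplete (Ideal.span {flat p π hπ}) B)
    [IsIntegralPerfectoid p (untiltObj p π hπ0 hπ B)] :
    tiltObj p S (untiltObj p π hπ0 hπ B) ≅ CommAlgCat.of (PreTilt S p) B :=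
  letI := (untiltStr p π hπ0 hπ B).toAlgebra
  haveI : IsIntegralPerfectoid p (UntiltRing p (algebraMap (PreTilt S p) B (flat p π hπ))) :=
    ‹IsIntegralPerfectoid p (untiltObj p π hπ0 hπ B)›
  letI := (tiltMap p (untiltStr p π hπ0 hπ B)).toAlgebra
  (CommAlgCat.isoMk (X := B)
    (Y := PreTilt (UntiltRing p (algebraMap (PreTilt S p) B (flat p π hπ))) p)
    { preTiltUntiltEquiv (algebraMap (PreTilt S p) B (flat p π hπ))
        (isAdicComplete_span_singleton_algebraMap_iff.2 hB) with
      commutes' := fun s => toPreTiltUntilt_algebraMap hπ0 hπ s }).symm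

theorem tiltUntiltIso_naturality {B C : Type v} [CommRing B] [Algebra (PreTilt S p) B] [CharP B p]
    [PerfectRing B p] (hB : IsAdicComplete (Ideal.span {flat p π hπ}) B)
    [IsIntegralPerfectoid p (untiltObj p π hπ0 hπ B)] [CommRing C] [Algebra (PreTilt S p) C]
    [CharP C p] [PerfectRing C p] (hC : IsAdicComplete (Ideal.span {flat p π hπ}) C)
    [IsIntegralPerfectoid p (untiltObj p π hπ0 hπ C)] (g : B →ₐ[PreTilt S p] C) :
    tiltHom p S (untiltHom p π hπ0 hπ g).hom ≫ (tiltUntiltIso hπ0 hπ C hC).hom =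
      (tiltUntiltIso hπ0 hπ B hB).hom ≫ CommAlgCat.ofHom g := by
  rw [← Iso.eq_comp_inv, Category.assoc, ← Iso.inv_comp_eq, eq_comm]
  have h1 : IsIntegralPerfectoid p (UntiltRing p (algebraMap (PreTilt S p) B (flat p π hπ))) :=
    ‹IsIntegralPerfectoid p (untiltObj p π hπ0 hπ B)›
  have h2 : IsIntegralPerfectoid p (UntiltRing p (algebraMap (PreTilt S p) C (flat p π hπ))) :=
    ‹IsIntegralPerfectoid p (untiltObj p π hπ0 hπ C)›
  apply CommAlgCat.hom_ext
  apply AlgHom.ext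
  intro b
  exact toPreTiltUntilt_naturality (p := p) (algebraMap (PreTilt S p) B (flat p π hπ))
    (algebraMap (PreTilt S p) C (flat p π hπ)) g.toRingHom
    (untiltHom p π hπ0 hπ g).hom.toRingHom (fun w => rfl) b

end Isos

end

/-! ### The equivalence of categories -/

theorem proposition6p8 {p : ℕ} [Fact p.Prime]
    {R : Type w} [CommRing R] [IsDomain R] [IsLocalRing R] [IsNoetherianRing R]
    [IsAdicComplete (IsLocalRing.maximalIdeal R) R]
    [CharZero R] [CharP (IsLocalRing.ResidueField R) p]
    {n : ℕ} (x : Fin (n + 1) → R) (hx : IsSystemOfParameters x) (hx0 : x 0 = p)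
    {S : Type u} [CommRing S] [Algebra R S] [IsIntegralPerfectoid p S]
    (r : Fin (n + 1) → ℕ → S) (hr0 : ∀ i, r i 0 = algebraMap R S (x i))
    (hr : ∀ i k, r i (k + 1) ^ p = r i k) :
    ∃ (htilt : ∀ T : (perfectoidBCM.{u, v} p S
          (List.ofFn fun i => algebraMap R S (x i))).FullSubcategory,
        perfectBCM.{u, v} p S (flat p (r 0) (hr 0)) (List.ofFn fun i => flat p (r i) (hr i))
          ((tiltFunctor p S (List.ofFn fun i => algebraMap R S (x i))).obj T))
      (huntilt : ∀ T : (perfectBCM.{u, v} p S (flat p (r 0) (hr 0))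
          (List.ofFn fun i => flat p (r i) (hr i))).FullSubcategory,
        perfectoidBCM.{u, v} p S (List.ofFn fun i => algebraMap R S (x i))
          ((untiltFunctor p (r 0) (compatible_zero_eq p hx0 (hr0 0)) (hr 0)).obj T.obj))
      (e : (perfectoidBCM.{u, v} p S (List.ofFn fun i => algebraMap R S (x i))).FullSubcategory ≌
        (perfectBCM.{u, v} p S (flat p (r 0) (hr 0))
          (List.ofFn fun i => flat p (r i) (hr i))).FullSubcategory),
      e.functor = ObjectProperty.lift _
        (tiltFunctor p S (List.ofFn fun i => algebraMap R S (x i))) htilt ∧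
      e.inverse = ObjectProperty.lift _
        (ObjectProperty.ι _ ⋙
          untiltFunctor p (r 0) (compatible_zero_eq p hx0 (hr0 0)) (hr 0)) huntilt := by
  have hπ0 := compatible_zero_eq p hx0 (hr0 0)
  have htilt : ∀ T : (perfectoidBCM.{u, v} p S
          (List.ofFn fun i => algebraMap R S (x i))).FullSubcategory,
        perfectBCM.{u, v} p S (flat p (r 0) (hr 0)) (List.ofFn fun i => flat p (r i) (hr i))
          ((tiltFunctor p S (List.ofFn fun i => algebraMap R S (x i))).obj T) := fun T =>
    have := T.property.1
    tiltObj_mem_perfectBCM (fun i => algebraMap R S (x i)) (by rw [hx0, map_natCast]) r hr0 hr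
      T.obj T.property.2
  have huntilt : ∀ T : (perfectBCM.{u, v} p S (flat p (r 0) (hr 0))
          (List.ofFn fun i => flat p (r i) (hr i))).FullSubcategory,
        perfectoidBCM.{u, v} p S (List.ofFn fun i => algebraMap R S (x i))
          ((untiltFunctor p (r 0) hπ0 (hr 0)).obj T.obj) := fun T =>
    have := T.property.2.1
    untiltObj_mem_perfectoidBCM (fun i => algebraMap R S (x i)) r hr0 hπ0 hr T.obj T.property.2.2
  -- Regularity makes the algebra nontrivial, so `p = 0` forces its characteristic to be exactly
  -- `p`.
  have hchar : ∀ T : (perfectBCM.{u, v} p S (flat p (r 0) (hr 0))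
      (List.ofFn fun i => flat p (r i) (hr i))).FullSubcategory, CharP T.obj p := fun T =>
    have := RingTheory.Sequence.IsRegular.nontrivial T.property.2.2
    charP_of_preTilt_algebra (S := S) T.obj
  -- `Equivalence.mk` may replace a natural isomorphism to obtain the triangle identity but keeps
  -- both functors, so the last two equalities are definitional.
  refine ⟨htilt, huntilt, CategoryTheory.Equivalence.mk _ _ ?_ ?_, rfl, rfl⟩
  · refine NatIso.ofComponents (fun T => ObjectProperty.isoMk _
      (haveI := T.property.1; (untiltTiltIso hπ0 (hr 0) T.obj).symm)) fun {T T'} f => ?_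
    have := T.property.1
    have := T'.property.1
    apply ObjectProperty.hom_ext
    exact untiltTiltIso_naturality hπ0 (hr 0) f.hom.hom
  · refine NatIso.ofComponents (fun T => ObjectProperty.isoMk _
      (haveI := T.property.2.1; haveI := hchar T
       haveI : IsIntegralPerfectoid p (untiltObj p (r 0) hπ0 (hr 0) T.obj) := (huntilt T).1
       tiltUntiltIso hπ0 (hr 0) T.obj T.property.1)) fun {T T'} f => ?_
    have := T.property.2.1
    have := hchar T
    have : IsIntegralPerfectoid p (untiltObj p (r 0) hπ0 (hr 0) T.obj) := (huntilt T).1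
    have := T'.property.2.1
    have := hchar T'
    have : IsIntegralPerfectoid p (untiltObj p (r 0) hπ0 (hr 0) T'.obj) := (huntilt T').1
    apply ObjectProperty.hom_ext
    exact tiltUntiltIso_naturality hπ0 (hr 0) T.property.1 T'.property.1 f.hom.hom
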